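/- **Setting.** A transmitter with $L\ge 1$ antennas and a library of $N\ge K=K_1+K_2$ equally long files serves $K$ single-antenna users over the Gaussian MISO broadcast channel $y_k=\mathbf h_k^H\mathbf x+w_k$, $w_k\sim\mathbb{CN}(0,1)$, with power constraint $\mathbb E\|\mathbf x\|^2\le P$. Any $L$ or fewer of the channel vectors $\mathbf h_k\in\mathbb C^L$ are linearly independent and all channels are known everywhere. User $k$ has a cache holding a fraction $\gamma^{(k)}$ of the library, filled before the demands, the channels and $P$ are known; then the users request different files. A (normalized, worst-case) delay $T$ is *achievable* if some placement allows, for all such channels, all $\varepsilon>0$ and all sufficiently large $P$, delivery of files of arbitrarily large size $F$ bits, for every vector of different demands, within $(T+\varepsilon)F/\log_2P$ channel uses and with arbitrarily small error probability. **Claim.** Let $K_1\ge 1$ users have caches of normalized size $\gamma_1\in(0,1)$ with $K_1\gamma_1$ an integer, let the other $K_2\ge0$ users have no caches ($\gamma_2=0$), and put $$T_{K_1}=\frac{K_1(1-\gamma_1)}{1+K_1\gamma_1},\qquad \gamma_{\rm av}=\frac{K_1\gamma_1}{K},\qquad T=\frac{K_2+K_1(1-\gamma_1)}{L+K_1\gamma_1}.$$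 Assume $K_2\le (L-1)T_{K_1}$, and that $T$ is not smaller than the time that a single user needs on its own, i.e. $T\ge 1$ if $K_2\ge1$ (equivalently $L+2K_1\gamma_1\le K$), and $T\ge 1-\gamma_1$ if $K_2=0$. Then $T$ is an achievable delay of this system, and $$T=\frac{K(1-\gamma_{\rm av})}{L+K\gamma_{\rm av}}.$$ This is also an achievable delay of the homogeneous $K$-user system in which every user has a cache of normalized size $\gamma_{\rm av}$ (same cumulative cache size $K\gamma_{\rm av}=K_1\gamma_1$). For that homogeneous system it is order optimal: it is attained by a linear one-shot scheme, and it is at most $2$ times the delay of any linear one-shot scheme. Here a linear one-shot scheme splits each file into $S$ packets; each user caches a set of packets within its cache size; in each slot, of duration $1/S$, each of some users is sent one packet of its requested file along a beamforming vector, such that the user hears this packet and every other packet sent in that slot is cached at the user or nulled out at it; and every requested packet not cached at its user is sent in some slot. -/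

import Mathlib

open MeasureTheory ProbabilityTheory Filter

noncomputable section

/-- Circularly symmetric complex Gaussian law of unit variance: independent real and imaginary
parts, each of variance `1/2`. -/
def complexGaussian : Measure ℂ :=
  ((gaussianReal 0 (1 / 2)).prod (gaussianReal 0 (1 / 2))).map
    Complex.measurableEquivRealProd.symm

/-- A library of `N` files of `F` bits each. -/
abbrev Library (N F : ℕ) : Type := Fin N → Fin F → Bool

/-- The channels of `K` single-antenna users to an `L`-antenna transmitter. -/
abbrev Channel (L K : ℕ) : Type := Fin K → EuclideanSpace ℂ (Fin L)

/-- Any `L` (or fewer) of the channel vectors are linearly independent. -/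
def Channel.Generic {L K : ℕ} (h : Channel L K) : Prop :=
  ∀ s : Finset (Fin K), s.card ≤ L → LinearIndependent ℂ (fun k : s => h k)

/-- A cache placement: user `k` stores `bits k` bits that are a function of the library, at most
the fraction `γ k` of the `N * F` bits of the library. It knows neither the demands, nor the
channel, nor the power. -/
structure Placement {K : ℕ} (γ : Fin K → ℝ) (N F : ℕ) where
  bits : Fin K → ℕ
  store : (k : Fin K) → Library N F → (Fin (bits k) → Bool)
  bits_le : ∀ k, (bits k : ℝ) ≤ γ k * (N * F)

/-- A delivery scheme of `n` channel uses over the multiple-input single-output broadcast channel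
`y k = ⟪h k, x⟫ + w k` with transmit power `P` (expectation over uniformly distributed files).
Demands are vectors of different files. For every demand vector and every content of the library,
every user recovers its requested file from its received signal and its cache, with probability of
error at most `δ`. -/
structure Delivery {L K N F : ℕ} {γ : Fin K → ℝ} (Z : Placement γ N F) (h : Channel L K)
    (P : ℝ) (n : ℕ) (δ : ℝ) where
  transmit : (Fin K ↪ Fin N) → Library N F → Fin n → EuclideanSpace ℂ (Fin L)
  decode : (k : Fin K) → (Fin K ↪ Fin N) → (Fin (Z.bits k) → Bool) → (Fin n → ℂ) →
    (Fin F → Bool)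
  power_le : ∀ d i,
    (∑ W : Library N F, ‖transmit d W i‖ ^ 2) / (Fintype.card (Library N F) : ℝ) ≤ P
  measurable_decode : ∀ k d z, Measurable (decode k d z)
  error_le : ∀ k d W,
    Measure.pi (fun _ : Fin n => complexGaussian)
      {w | decode k d (Z.store k W) (fun i => inner ℂ (h k) (transmit d W i) + w i) ≠ W (d k)}
      ≤ ENNReal.ofReal δ

/-- The worst-case normalized delay `T` is achievable, in the degrees-of-freedom sense, in the
`L`-antenna broadcast channel with `N` files and users of normalized cache sizes `γ k`. The unit of
time is `F / log P` channel uses, the time in which a link of capacity `log P` carries one file.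
At every sufficiently large power the delay is at most `T + ε` with vanishing probability of error
for long files. The placement depends on the file size only. -/
def AchievesDelay (L N : ℕ) {K : ℕ} (γ : Fin K → ℝ) (T : ℝ) : Prop :=
  ∃ Z : (F : ℕ) → Placement γ N F,
    ∀ h : Channel L K, h.Generic →
      ∀ ε : ℝ, 0 < ε → ∀ᶠ P : ℝ in atTop,
        ∀ δ : ℝ, 0 < δ → ∀ F₀ : ℕ, ∃ F ≥ F₀, ∃ n : ℕ,
          (n : ℝ) * Real.logb 2 P ≤ (T + ε) * F ∧
          Nonempty (Delivery (Z F) h P n δ)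

/-- A linear one-shot scheme: each file consists of `S` packets, user `k` stores at most the
fraction `γ k` of all packets, and for each vector of different demands there are `n` slots. In a
slot, each active user `k` is sent one packet of its file along the beamforming vector `beam k`.
The user hears this packet, and every other packet sent in the slot is cached at the user or nulled
out at it. Every requested packet that is not cached at its user is sent in some slot. A slot takes
`1 / S` units of time. -/
structure OneShotScheme {L K : ℕ} (h : Channel L K) (N : ℕ) (γ : Fin K → ℝ) (S n : ℕ) where
  cached : Fin K → Finset (Fin N × Fin S)
  cached_le : ∀ k, ((cached k).card : ℝ) ≤ γ k * (N * S)
  active : (Fin K ↪ Fin N) → Fin n → Finset (Fin K)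
  packet : (Fin K ↪ Fin N) → Fin n → Fin K → Fin S
  beam : (Fin K ↪ Fin N) → Fin n → Fin K → EuclideanSpace ℂ (Fin L)
  desired : ∀ d i, ∀ k ∈ active d i, inner ℂ (h k) (beam d i k) ≠ 0
  interference : ∀ d i, ∀ k ∈ active d i, ∀ j ∈ active d i, j ≠ k →
    (d j, packet d i j) ∈ cached k ∨ inner ℂ (h k) (beam d i j) = 0
  complete : ∀ d k s, (d k, s) ∉ cached k → ∃ i, k ∈ active d i ∧ packet d i k = s

/-- Among linear one-shot schemes, the delay `T` is attained and is within a factor `c` of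
the smallest possible delay. -/
def OrderOptimalOneShot (L N : ℕ) {K : ℕ} (γ : Fin K → ℝ) (T c : ℝ) : Prop :=
  ∀ h : Channel L K, h.Generic →
    (∃ S n : ℕ, 0 < S ∧ (n : ℝ) / S = T ∧ Nonempty (OneShotScheme h N γ S n)) ∧
    (∀ S n : ℕ, 0 < S → Nonempty (OneShotScheme h N γ S n) → T ≤ c * ((n : ℝ) / S))

/-- `K₁` users with caches of normalized size `γ₁`, followed by `K₂` cache-less users. -/
def twoTypeCaches (K₁ K₂ : ℕ) (γ₁ : ℝ) : Fin (K₁ + K₂) → ℝ :=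
  fun k => if (k : ℕ) < K₁ then γ₁ else 0

/-- `T_K = K(1-γ)/(1+Kγ)`: the delay of `K` users with caches of normalized size `γ` served by
one antenna. -/
def singleStreamDelay (K : ℕ) (γ : ℝ) : ℝ := K * (1 - γ) / (1 + K * γ)

end

/-! Put `t = K₁ * γ₁` and `K = K₁ + K₂`. Both systems have cumulative cache size `t`, and both
delays equal `(K - t) / (L + t)`: every slot serves `L + t` users, because a packet is cached at `t`
of the other active users and nulled out at the remaining `L - 1`.

Achievability separates into combinatorics and coding. Packets are indexed by `t`-sets of caching
users. A few base groups of `L + t` active users are translated by all permutations of the caching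
and of the cache-less users; by symmetry every user then receives each class of packets it lacks
equally often (`card_orbit_mul_card_hits`, `exists_oneShotScheme_twoType`). The bound on `K₂` leaves
at least `t + 1` caching users for each group, and the lower bound on the delay leaves enough users
to fill it. The homogeneous system is the case without cache-less users.

A one-shot scheme becomes a scheme for the Gaussian channel (`achievesDelay_of_oneShotScheme`):
users subtract the cached interference, and each packet crosses a point-to-point link by a
Gilbert–Varshamov code over a square grid, which corrects the rare large noise samples at a rate
close to `log P`.

For the converse (`OneShotScheme.le_delay`), a slot that carries a packet with `c` cached copies has
at most `L + c` active users. Averaging over cyclic demands and convexity of `(K - c) / (L + c)`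
yield `(K - τ) / (L + τ)` for cumulative cache size `τ`. The homogeneous scheme is thus exactly
optimal among one-shot schemes, and the factor `2` is slack. -/

/-! ### Block codes over a complex grid -/

/-- A word of the ball agrees with `x` outside a set of fewer than `d` positions; there are at most
`2 ^ |ι|` such sets and `|α| ^ d` words for each. -/
theorem card_hammingDist_lt_le {ι α : Type*} [Fintype ι] [DecidableEq ι] [Fintype α]
    [DecidableEq α] [Nonempty α] (x : ι → α) (d : ℕ) :
    (Finset.univ.filter fun y : ι → α => hammingDist x y < d).card ≤
      2 ^ Fintype.card ι * Fintype.card α ^ d := by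
  have hsub : (Finset.univ.filter fun y : ι → α => hammingDist x y < d) ⊆
      (Finset.univ.filter fun T : Finset ι => T.card < d).biUnion
        fun T => Finset.univ.filter fun y : ι → α => ∀ i, i ∉ T → x i = y i := by
    intro y hy
    simp only [Finset.mem_filter, Finset.mem_univ, true_and, Finset.mem_biUnion] at hy ⊢
    exact ⟨Finset.univ.filter fun i => x i ≠ y i, hy, fun i hi => by simpa using hi⟩
  refine (Finset.card_le_card hsub).trans ((Finset.card_biUnion_le_card_mul _ _
    (Fintype.card α ^ d) ?_).trans ?_)
  · intro T hT
    have hT' : T.card < d := by simpa using hT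
    have hinj : (Finset.univ.filter fun y : ι → α => ∀ i, i ∉ T → x i = y i).card ≤
        (Finset.univ : Finset (T → α)).card := by
      refine Finset.card_le_card_of_injOn (fun y i => y i) 
        (fun _ _ => Finset.mem_coe.2 (Finset.mem_univ _)) ?_
      intro y hy z hz hyz
      simp only [Finset.coe_filter, Finset.mem_univ, true_and, Set.mem_ofPred_eq] at hy hz
      funext i
      by_cases hi : i ∈ T
      · exact congrFun hyz ⟨i, hi⟩
      · rw [← hy i hi, hz i hi]
    refine hinj.trans ?_
    rw [Finset.card_univ, Fintype.card_fun, Fintype.card_coe]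
    exact Nat.pow_le_pow_right Fintype.card_pos hT'.le
  · refine Nat.mul_le_mul_right _ ((Finset.card_filter_le _ _).trans ?_)
    rw [Finset.card_univ, Fintype.card_finset]

/-- Gilbert–Varshamov bound. -/
theorem exists_code_hammingDist (ι α : Type*) [Fintype ι] [DecidableEq ι] [Fintype α]
    [DecidableEq α] [Nonempty α] (d : ℕ) :
    ∃ C : Finset (ι → α), (∀ x ∈ C, ∀ y ∈ C, x ≠ y → d ≤ hammingDist x y) ∧
      Fintype.card α ^ Fintype.card ι ≤
        C.card * (2 ^ Fintype.card ι * Fintype.card α ^ d) := by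
  classical
  obtain ⟨C, hC, hmax⟩ := ((Finset.univ : Finset (Finset (ι → α))).filter fun C =>
    ∀ x ∈ C, ∀ y ∈ C, x ≠ y → d ≤ hammingDist x y).exists_max_image Finset.card ⟨∅, by simp⟩
  simp only [Finset.mem_filter, Finset.mem_univ, true_and] at hC hmax
  refine ⟨C, hC, ?_⟩
  -- A word outside all balls could be added to the maximal code. Inserting `x` matters only for `d
  -- = 0`, where its ball is empty.
  have hcover : (Finset.univ : Finset (ι → α)) ⊆ C.biUnion fun x =>
      insert x (Finset.univ.filter fun y : ι → α => hammingDist x y < d) := by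
    intro y _
    by_contra hy
    simp only [Finset.mem_biUnion, Finset.mem_insert, Finset.mem_filter, Finset.mem_univ,
      true_and, not_exists, not_and, not_or, not_lt] at hy
    have hyC : y ∉ C := fun h => (hy y h).1 rfl
    have := hmax (insert y C) (by
      intro a ha b hb hab
      rcases Finset.mem_insert.1 ha with rfl | ha' <;>
        rcases Finset.mem_insert.1 hb with rfl | hb'
      · exact absurd rfl hab
      · rw [hammingDist_comm]; exact (hy b hb').2
      · exact (hy a ha').2
      · exact hC a ha' b hb' hab)
    rw [Finset.card_insert_of_notMem hyC] at this
    omega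
  have hball : ∀ x ∈ C, (insert x (Finset.univ.filter fun y : ι → α => hammingDist x y < d)).card
      ≤ 2 ^ Fintype.card ι * Fintype.card α ^ d := by
    intro x _
    rcases Nat.eq_zero_or_pos d with rfl | hd
    · simpa using Nat.one_le_two_pow
    · rw [Finset.insert_eq_of_mem (by simpa using hd)]
      exact card_hammingDist_lt_le x d
  have := (Finset.card_le_card hcover).trans (Finset.card_biUnion_le_card_mul _ _ _ hball)
  rwa [Finset.card_univ, Fintype.card_fun] at this

/-- A block code for `B` bits of length `l` over the complex numbers with symbols of modulus at
most `R`, which corrects all noise with fewer than `e` entries of modulus larger than `A`. -/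
structure LinkCode (B l e : ℕ) (A R : ℝ) where
  enc : (Fin B → Bool) → Fin l → ℂ
  dec : (Fin l → ℂ) → Fin B → Bool
  measurable_dec : Measurable dec
  norm_enc_le : ∀ m i, ‖enc m i‖ ≤ R
  dec_enc_add : ∀ m, ∀ w : Fin l → ℂ, (Finset.univ.filter fun i => A < ‖w i‖).card < e →
    dec (fun i => enc m i + w i) = m

/-- Used to make the decoder measurable: the preimage of any set is a finite union of regions,
possibly together with the complement of all regions, which is sent to `default`. -/
theorem measurable_of_disjoint_regions {X Y : Type*} [MeasurableSpace X] [MeasurableSpace Y]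
    [Finite Y] [Inhabited Y] (D : Y → Set X) (hD : ∀ m, MeasurableSet (D m))
    (hdisj : ∀ m m', ∀ x ∈ D m, x ∈ D m' → m = m') :
    ∃ f : X → Y, Measurable f ∧ ∀ m, ∀ x ∈ D m, f x = m := by
  classical
  have key : ∀ m, ∀ x ∈ D m, (if h : ∃ m, x ∈ D m then h.choose else default) = m := by
    intro m x hx
    have h : ∃ m, x ∈ D m := ⟨m, hx⟩
    rw [dif_pos h]
    exact hdisj _ _ x h.choose_spec hx
  refine ⟨fun x => if h : ∃ m, x ∈ D m then h.choose else default, ?_, key⟩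
  intro s _
  have : (fun x => if h : ∃ m, x ∈ D m then h.choose else default) ⁻¹' s =
      (⋃ m ∈ s, D m) ∪ ((⋃ m, D m)ᶜ ∩ {_x | default ∈ s}) := by
    ext x
    by_cases h : ∃ m, x ∈ D m
    · obtain ⟨m, hm⟩ := h
      have h' : ∃ m, x ∈ D m := ⟨m, hm⟩
      rw [Set.mem_preimage, key m x hm]
      simp only [Set.mem_union, Set.mem_iUnion, Set.mem_inter_iff, Set.mem_compl_iff, h',
        not_true_eq_false, false_and, or_false, exists_prop]
      exact ⟨fun hs => ⟨m, hs, hm⟩, fun ⟨m', hs, hm'⟩ => hdisj m m' x hm hm' ▸ hs⟩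
    · have h2 : ∀ m, x ∉ D m := fun m hm => h ⟨m, hm⟩
      simp [h2]
  rw [this]
  refine (MeasurableSet.biUnion (Set.to_countable s) fun m _ => hD m).union
    ((MeasurableSet.iUnion hD).compl.inter ?_)
  by_cases h : (default : Y) ∈ s <;> simp [h]

/-- Points of a square grid of mesh `3 * A`. -/
def gridPoint (r : ℕ) (A : ℝ) (x : Fin (2 ^ r) × Fin (2 ^ r)) : ℂ :=
  ⟨3 * A * (x.1 : ℕ), 3 * A * (x.2 : ℕ)⟩

theorem norm_gridPoint_le (r : ℕ) {A : ℝ} (hA : 0 < A) (x : Fin (2 ^ r) × Fin (2 ^ r)) :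
    ‖gridPoint r A x‖ ≤ 6 * A * 2 ^ r := by
  refine (Complex.norm_le_abs_re_add_abs_im _).trans ?_
  have h (i : Fin (2 ^ r)) : |3 * A * ((i : ℕ) : ℝ)| ≤ 3 * A * 2 ^ r := by
    rw [abs_of_nonneg (by positivity)]
    have : ((i : ℕ) : ℝ) ≤ 2 ^ r := by exact_mod_cast i.2.le
    gcongr
  have := h x.1
  have := h x.2
  simp only [gridPoint]
  linarith

/-- The mesh exceeds `2 * A`, so closed discs of radius `A` about different grid points are
disjoint. -/
theorem lt_norm_gridPoint_sub (r : ℕ) {A : ℝ} (hA : 0 < A) {x y : Fin (2 ^ r) × Fin (2 ^ r)}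
    (hxy : x ≠ y) : 2 * A < ‖gridPoint r A x - gridPoint r A y‖ := by
  have h (i j : Fin (2 ^ r)) (hij : i ≠ j) :
      2 * A < |3 * A * ((i : ℕ) : ℝ) - 3 * A * ((j : ℕ) : ℝ)| := by
    rw [← mul_sub, abs_mul, abs_of_pos (by positivity)]
    have hne : ((i : ℕ) : ℤ) - ((j : ℕ) : ℤ) ≠ 0 := by
      intro h0
      exact hij (Fin.ext (by omega))
    have h1 : (1 : ℝ) ≤ |((i : ℕ) : ℝ) - ((j : ℕ) : ℝ)| := by
      exact_mod_cast Int.one_le_abs hne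
    nlinarith
  by_cases h1 : x.1 = y.1
  · have h2 : x.2 ≠ y.2 := fun h2 => hxy (Prod.ext h1 h2)
    exact (h _ _ h2).trans_le (by
      simpa [gridPoint] using
        Complex.abs_im_le_norm (gridPoint r A x - gridPoint r A y))
  · exact (h _ _ h1).trans_le (by
      simpa [gridPoint] using
        Complex.abs_re_le_norm (gridPoint r A x - gridPoint r A y))

/-- At minimum distance `2 * e`, fewer than `e` bad positions for each of two codewords cannot
account for all the positions where they differ. Over `4 ^ r` symbols the Gilbert–Varshamov bound
leaves `(2 * r * u - u - 4 * r) * e` bits, whence `hb`. -/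
theorem exists_linkCode (u e r b : ℕ) {A : ℝ} (hA : 0 < A) (hb : b + u + 4 * r ≤ 2 * r * u) :
    Nonempty (LinkCode (b * e) (u * e) e A (6 * A * 2 ^ r)) := by
  classical
  obtain ⟨C, hC, hcard⟩ :=
    exists_code_hammingDist (Fin (u * e)) (Fin (2 ^ r) × Fin (2 ^ r)) (2 * e)
  have hsize : 2 ^ (b * e) ≤ C.card := by
    simp only [Fintype.card_prod, Fintype.card_fin, ← pow_add, ← pow_mul] at hcard
    by_contra! hlt
    have h1 : 2 ^ ((r + r) * (u * e)) <
        2 ^ (b * e + (u * e + (r + r) * (2 * e))) := by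
      rw [pow_add]
      exact hcard.trans_lt (Nat.mul_lt_mul_of_pos_right hlt (by positivity))
    have h2 := (Nat.pow_lt_pow_iff_right (by norm_num : 1 < 2)).1 h1
    have h3 := Nat.mul_le_mul_right e hb
    nlinarith
  obtain ⟨f⟩ : Nonempty ((Fin (b * e) → Bool) ↪ C) := by
    refine Function.Embedding.nonempty_of_card_le ?_
    simpa using hsize
  let D : (Fin (b * e) → Bool) → Set (Fin (u * e) → ℂ) := fun m =>
    {y | (Finset.univ.filter fun i => A < ‖y i - gridPoint r A ((f m).1 i)‖).card < e}
  have hDmeas : ∀ m, MeasurableSet (D m) := by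
    intro m
    have : Measurable fun y : Fin (u * e) → ℂ =>
        (Finset.univ.filter fun i => A < ‖y i - gridPoint r A ((f m).1 i)‖).card := by
      simp only [Finset.card_filter]
      refine Finset.measurable_sum _ fun i _ => Measurable.ite ?_ measurable_const measurable_const
      exact measurableSet_lt measurable_const (by fun_prop)
    exact measurableSet_lt this measurable_const
  have hdisj : ∀ m m', ∀ x ∈ D m, x ∈ D m' → m = m' := by
    intro m m' x hx hx'
    by_contra hne
    have hfne : (f m).1 ≠ (f m').1 := fun h => hne (f.injective (Subtype.ext h))
    have hd := hC _ (f m).2 _ (f m').2 hfne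
    have hsub : (Finset.univ.filter fun i => (f m).1 i ≠ (f m').1 i) ⊆
        (Finset.univ.filter fun i => A < ‖x i - gridPoint r A ((f m).1 i)‖) ∪
        (Finset.univ.filter fun i => A < ‖x i - gridPoint r A ((f m').1 i)‖) := by
      intro i hi
      simp only [Finset.mem_filter, Finset.mem_univ, true_and, Finset.mem_union] at hi ⊢
      by_contra! hcon
      have h1 := lt_norm_gridPoint_sub r hA hi
      have h2 := norm_sub_le (x i - gridPoint r A ((f m').1 i))
        (x i - gridPoint r A ((f m).1 i))
      rw [sub_sub_sub_cancel_left] at h2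
      linarith
    have h3 := (Finset.card_le_card hsub).trans (Finset.card_union_le _ _)
    simp only [D, Set.mem_ofPred_eq] at hx hx'
    unfold hammingDist at hd
    omega
  obtain ⟨dec, hdec, hdec'⟩ := measurable_of_disjoint_regions D hDmeas hdisj
  exact ⟨⟨fun m i => gridPoint r A ((f m).1 i), dec, hdec,
    fun m i => norm_gridPoint_le r hA _, fun m w hw => hdec' m _ (by simpa [D] using hw)⟩⟩

/-! ### Large noise samples are rare -/

instance : IsProbabilityMeasure complexGaussian :=
  Measure.isProbabilityMeasure_map Complex.measurableEquivRealProd.symm.measurable.aemeasurable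

/-- Continuity from above. The threshold `A` depends on `p` only, so it stays fixed while the power
grows. -/
theorem exists_measure_lt_norm_le {E : Type*} [NormedAddCommGroup E] [MeasurableSpace E]
    [OpensMeasurableSpace E] (μ : Measure E) [IsFiniteMeasure μ] {p : ENNReal} (hp : 0 < p) :
    ∃ A : ℝ, 0 < A ∧ μ {w | A < ‖w‖} ≤ p := by
  have h : Tendsto (fun n : ℕ => μ {w | (n : ℝ) < ‖w‖}) atTop
      (nhds (μ (⋂ n : ℕ, {w | (n : ℝ) < ‖w‖}))) := by
    refine tendsto_measure_iInter_atTop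
      (fun n => (measurableSet_lt measurable_const measurable_norm).nullMeasurableSet) ?_
      ⟨0, measure_ne_top _ _⟩
    intro m n hmn w hw
    simp only [Set.mem_ofPred_eq] at hw ⊢
    have : (m : ℝ) ≤ n := by exact_mod_cast hmn
    linarith
  have hempty : (⋂ n : ℕ, {w : E | (n : ℝ) < ‖w‖}) = ∅ := by
    ext w
    obtain ⟨n, hn⟩ := exists_nat_gt ‖w‖
    simp only [Set.mem_iInter, Set.mem_ofPred_eq, Set.mem_empty_iff_false, iff_false, not_forall,
      not_lt]
    exact ⟨n, hn.le⟩
  rw [hempty, measure_empty] at h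
  obtain ⟨n, hn, hn'⟩ := ((h.eventually (gt_mem_nhds hp)).and (eventually_gt_atTop 0)).exists
  exact ⟨n, by exact_mod_cast hn', hn.le⟩

theorem measure_pi_forall_mem_eq {ι X : Type*} [Fintype ι] [MeasurableSpace X] (μ : Measure X)
    [IsProbabilityMeasure μ] (J : Finset ι) (s : Set X) :
    Measure.pi (fun _ : ι => μ) {w | ∀ j ∈ J, w j ∈ s} = μ s ^ J.card := by
  classical
  have : {w : ι → X | ∀ j ∈ J, w j ∈ s} = Set.univ.pi fun j => if j ∈ J then s else Set.univ := by
    ext w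
    simp only [Set.mem_ofPred_eq, Set.mem_pi, Set.mem_univ, true_imp_iff]
    refine forall_congr' fun j => ?_
    by_cases hj : j ∈ J <;> simp [hj]
  rw [this, Measure.pi_pi]
  have h2 : ∀ j, μ (if j ∈ J then s else Set.univ) = if j ∈ J then μ s else 1 := by
    intro j; by_cases hj : j ∈ J <;> simp [hj]
  simp_rw [h2]
  rw [Finset.prod_ite_mem, Finset.univ_inter, Finset.prod_const]

/-- The probability that, in one of `n` blocks of `l` independent samples each, at least `e`
samples lie in a set `s` of probability at most `p`. -/
theorem measure_pi_exists_block_le {X : Type*} [MeasurableSpace X] (μ : Measure X)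
    [IsProbabilityMeasure μ] (s : Set X) [DecidablePred (· ∈ s)] {p : ENNReal} (hp : μ s ≤ p)
    (n l e : ℕ) :
    Measure.pi (fun _ : Fin (n * l) => μ) {w | ∃ i : Fin n, e ≤ (Finset.univ.filter fun j : Fin l =>
        w (finProdFinEquiv (i, j)) ∈ s).card} ≤ n * (2 ^ l * p ^ e) := by
  classical
  -- Union bound over the block and the `e` positions of its outliers.
  have hsub : {w : Fin (n * l) → X | ∃ i : Fin n, e ≤ (Finset.univ.filter fun j : Fin l =>
        w (finProdFinEquiv (i, j)) ∈ s).card} ⊆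
      ⋃ x ∈ (Finset.univ : Finset (Fin n)) ×ˢ (Finset.univ : Finset (Fin l)).powersetCard e,
        {w | ∀ j ∈ x.2.image (fun j => finProdFinEquiv (x.1, j)), w j ∈ s} := by
    rintro w ⟨i, hi⟩
    obtain ⟨T, hT, hcard⟩ := Finset.exists_subset_card_eq hi
    simp only [Set.mem_iUnion]
    refine ⟨(i, T), by simp [Finset.mem_powersetCard, hcard], ?_⟩
    intro j hj
    obtain ⟨j', hj', rfl⟩ := Finset.mem_image.1 hj
    simpa using hT hj'
  refine (measure_mono hsub).trans ((measure_biUnion_finset_le _ _).trans ?_)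
  refine (Finset.sum_le_card_nsmul _ _ (p ^ e) ?_).trans ?_
  · rintro ⟨i, T⟩ hx
    have hT : T.card = e := by simpa [Finset.mem_powersetCard] using hx
    rw [measure_pi_forall_mem_eq, Finset.card_image_of_injective, hT]
    · gcongr
    · intro a b hab
      simpa using hab
  · rw [Finset.card_product, Finset.card_univ, Fintype.card_fin, Finset.card_powersetCard,
      Finset.card_univ, Fintype.card_fin, nsmul_eq_mul, Nat.cast_mul, mul_assoc]
    gcongr
    exact_mod_cast Nat.choose_le_two_pow l e

/-! ### From linear one-shot schemes to the Gaussian channel -/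

/-- The `s`-th of `S` packets of a file. -/
def filePacket {F S : ℕ} (w : Fin F → Bool) (s : Fin S) (j : Fin (F / S)) : Bool :=
  w (Fin.castLE (Nat.mul_div_le F S) (finProdFinEquiv (s, j)))

theorem filePacket_eq_self {F S : ℕ} (hF : S * (F / S) = F) (w : Fin F → Bool) (f : Fin F) :
    filePacket w (finProdFinEquiv.symm (Fin.cast hF.symm f)).1
      (finProdFinEquiv.symm (Fin.cast hF.symm f)).2 = w f := by
  unfold filePacket
  congr 1
  rw [Prod.mk.eta, Equiv.apply_symm_apply]
  rfl

section Placement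

variable {K N S : ℕ} {γ : Fin K → ℝ} (cached : Fin K → Finset (Fin N × Fin S))

/-- The placement that stores whole packets of files of `F` bits. -/
noncomputable def packetPlacement (hS : 0 < S) (hcached : ∀ k, ((cached k).card : ℝ) ≤ γ k * (N * S)) (F : ℕ) :
    Placement γ N F where
  bits k := (cached k).card * (F / S)
  store k W x := filePacket (W ((cached k).equivFin.symm (finProdFinEquiv.symm x).1).1.1)
    ((cached k).equivFin.symm (finProdFinEquiv.symm x).1).1.2 (finProdFinEquiv.symm x).2
  bits_le k := by
    have hS' : (0 : ℝ) < S := by exact_mod_cast hS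
    -- The sign is forced by `hcached`, since cardinalities are nonnegative.
    have h0 : 0 ≤ γ k * N := by
      have := (Nat.cast_nonneg (α := ℝ) _).trans (hcached k)
      rw [← mul_assoc] at this
      exact nonneg_of_mul_nonneg_left this hS'
    have h1 : (S : ℝ) * (F / S : ℕ) ≤ F := by exact_mod_cast Nat.mul_div_le F S
    push_cast
    calc ((cached k).card : ℝ) * (F / S : ℕ) ≤ γ k * (N * S) * (F / S : ℕ) := by
          gcongr; exact hcached k
      _ = γ k * N * (S * (F / S : ℕ)) := by ring
      _ ≤ γ k * N * F := by gcongr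
      _ = γ k * (N * F) := by ring

/-- A packet read off the content of a cache; `false` if it is not there. -/
noncomputable def cachedPacket (k : Fin K) {B : ℕ} (z : Fin ((cached k).card * B) → Bool)
    (p : Fin N × Fin S) (j : Fin B) : Bool :=
  if hp : p ∈ cached k then z (finProdFinEquiv ((cached k).equivFin ⟨p, hp⟩, j)) else false

theorem cachedPacket_store (hS : 0 < S)
    (hcached : ∀ k, ((cached k).card : ℝ) ≤ γ k * (N * S)) {F : ℕ} (k : Fin K)
    (W : Library N F) {p : Fin N × Fin S} (hp : p ∈ cached k) :
    cachedPacket cached k ((packetPlacement cached hS hcached F).store k W) p =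
      filePacket (W p.1) p.2 := by
  funext j
  simp [cachedPacket, packetPlacement, hp]

end Placement

namespace OneShotScheme

variable {L K N S n : ℕ} {γ : Fin K → ℝ} {h : Channel L K}

/-- The same scheme with beamforming vectors scaled to unit gain at the intended user. -/
noncomputable def normalize (σ : OneShotScheme h N γ S n) : OneShotScheme h N γ S n where
  cached := σ.cached
  cached_le := σ.cached_le
  active := σ.active
  packet := σ.packet
  beam d i k := (inner ℂ (h k) (σ.beam d i k))⁻¹ • σ.beam d i k
  desired d i k hk := by
    rw [inner_smul_right, inv_mul_cancel₀ (σ.desired d i k hk)]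
    exact one_ne_zero
  interference d i k hk j hj hjk := by
    refine (σ.interference d i k hk j hj hjk).imp_right fun h0 => ?_
    rw [inner_smul_right, h0, mul_zero]
  complete := σ.complete

theorem inner_beam_normalize (σ : OneShotScheme h N γ S n) (d : Fin K ↪ Fin N) (i : Fin n)
    {k : Fin K} (hk : k ∈ σ.active d i) : inner ℂ (h k) (σ.normalize.beam d i k) = 1 := by
  simp only [normalize]
  rw [inner_smul_right, inv_mul_cancel₀ (σ.desired d i k hk)]

/-- Every slot of a linear one-shot scheme becomes a block of `l` channel uses, in which the
packets are sent with a block code. -/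
theorem nonempty_delivery (σ : OneShotScheme h N γ S n) (hS : 0 < S)
    (hunit : ∀ d i, ∀ k ∈ σ.active d i, inner ℂ (h k) (σ.beam d i k) = 1) {V : ℝ}
    (hV : ∀ d i, ∑ k ∈ σ.active d i, ‖σ.beam d i k‖ ≤ V) {F : ℕ} (hF : S * (F / S) = F)
    {l e : ℕ} {A R P δ : ℝ} (hR : 0 ≤ R) (c : LinkCode (F / S) l e A R) (hP : (R * V) ^ 2 ≤ P)
    {p : ENNReal} (hp : complexGaussian {w | A < ‖w‖} ≤ p)
    (hδ : n * (2 ^ l * p ^ e) ≤ ENNReal.ofReal δ) :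
    Nonempty (Delivery (packetPlacement σ.cached hS σ.cached_le F) h P (n * l) δ) := by
  classical
  have hslot : ∀ (k : Fin K) (d : Fin K ↪ Fin N) (s : Fin S), (d k, s) ∉ σ.cached k →
      ∃ i, k ∈ σ.active d i ∧ σ.packet d i k = s := fun k d s => σ.complete d k s
  choose slot hslot_active hslot_packet using hslot
  let x : (Fin K ↪ Fin N) → Library N F → Fin n → Fin l → EuclideanSpace ℂ (Fin L) :=
    fun d W i t => ∑ j ∈ σ.active d i,
      c.enc (filePacket (W (d j)) (σ.packet d i j)) t • σ.beam d i j
  have hx : ∀ d W i t, ‖x d W i t‖ ≤ R * V := by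
    intro d W i t
    refine (norm_sum_le _ _).trans ?_
    calc _ ≤ ∑ j ∈ σ.active d i, R * ‖σ.beam d i j‖ := by
          refine Finset.sum_le_sum fun j _ => ?_
          rw [norm_smul]
          gcongr
          exact c.norm_enc_le _ _
      _ = R * ∑ j ∈ σ.active d i, ‖σ.beam d i j‖ := by rw [Finset.mul_sum]
      _ ≤ R * V := by gcongr; exact hV d i
  -- The interference that user `k` can rebuild from its own cache and subtract; the other
  -- interfering packets are nulled out.
  let known : (k : Fin K) → (Fin K ↪ Fin N) →
      (Fin ((σ.cached k).card * (F / S)) → Bool) → Fin n → Fin l → ℂ :=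
    fun k d z i t => ∑ j ∈ (σ.active d i).erase k,
      if (d j, σ.packet d i j) ∈ σ.cached k then
        c.enc (cachedPacket σ.cached k z (d j, σ.packet d i j)) t * inner ℂ (h k) (σ.beam d i j)
      else 0
  let dec : (k : Fin K) → (Fin K ↪ Fin N) → (Fin ((σ.cached k).card * (F / S)) → Bool) →
      (Fin (n * l) → ℂ) → Fin F → Bool := fun k d z y f =>
    let q := finProdFinEquiv.symm (Fin.cast hF.symm f)
    if hq : (d k, q.1) ∈ σ.cached k then cachedPacket σ.cached k z (d k, q.1) q.2
    else c.dec (fun t => y (finProdFinEquiv (slot k d q.1 hq, t)) - known k d z (slot k d q.1 hq) t) q.2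
  have hreceive : ∀ (k : Fin K) d (W : Library N F) i t, k ∈ σ.active d i →
      inner ℂ (h k) (x d W i t) =
        c.enc (filePacket (W (d k)) (σ.packet d i k)) t +
        known k d ((packetPlacement σ.cached hS σ.cached_le F).store k W) i t := by
    intro k d W i t hk
    simp only [x, known]
    rw [inner_sum, ← Finset.add_sum_erase _ _ hk, inner_smul_right, hunit d i k hk, mul_one]
    congr 1
    refine Finset.sum_congr rfl fun j hj => ?_
    rw [inner_smul_right]
    obtain ⟨hjk, hj⟩ := Finset.mem_erase.1 hj
    split_ifs with hc
    · rw [cachedPacket_store σ.cached hS σ.cached_le k W hc]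
    · rw [(σ.interference d i k hk j hj hjk).resolve_left hc, mul_zero]
  refine ⟨⟨fun d W i => x d W (finProdFinEquiv.symm i).1 (finProdFinEquiv.symm i).2, dec, ?_, ?_,
    ?_⟩⟩
  · intro d i
    rw [div_le_iff₀ (by exact_mod_cast Fintype.card_pos)]
    refine (Finset.sum_le_card_nsmul _ _ P fun W _ => ?_).trans ?_
    -- The power constraint holds for each library content, not only on average.
    · exact (pow_le_pow_left₀ (norm_nonneg _) (hx d W _ _) 2).trans hP
    · rw [nsmul_eq_mul, mul_comm, Finset.card_univ]
  · intro k d z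
    refine measurable_pi_iff.2 fun f => ?_
    simp only [dec]
    split_ifs with hq
    · exact measurable_const
    · refine (measurable_pi_apply _).comp (c.measurable_dec.comp ?_)
      exact measurable_pi_iff.2 fun t => by fun_prop
  · intro k d W
    -- Decoding is certain to succeed unless some block has at least `e` noise samples above `A`.
    refine (measure_mono ?_).trans
      ((measure_pi_exists_block_le complexGaussian {w | A < ‖w‖} hp n l e).trans hδ)
    intro w hw
    by_contra hgood
    simp only [Set.mem_ofPred_eq, not_exists, not_le] at hw hgood
    refine hw (funext fun f => ?_)
    rw [← filePacket_eq_self hF (W (d k)) f]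
    simp only [dec]
    split_ifs with hq
    · rw [cachedPacket_store σ.cached hS σ.cached_le k W hq]
    · set s := (finProdFinEquiv.symm (Fin.cast hF.symm f)).1
      refine congrFun ?_ _
      refine Eq.trans ?_ (c.dec_enc_add (filePacket (W (d k)) s)
        (fun t => w (finProdFinEquiv (slot k d s hq, t))) (hgood (slot k d s hq)))
      congr 1
      funext t
      rw [Equiv.symm_apply_apply]
      simp only
      rw [hreceive k d W _ t (hslot_active k d s hq), hslot_packet k d s hq]
      ring

end OneShotScheme

/-! ### Choice of the code parameters -/

/-- With outlier probability `2⁻¹ ^ (u + 1)`, the factor `2 ^ (u * e)` of the union bound is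
absorbed and `n * 2⁻¹ ^ e` remains. -/
theorem exists_pow_inv_le {n F₀ : ℕ} (u : ℕ) {δ : ℝ} (hδ : 0 < δ) :
    ∃ e : ℕ, F₀ ≤ e ∧ n * (2 ^ (u * e) * ((2 : ENNReal) ^ (u + 1))⁻¹ ^ e) ≤ ENNReal.ofReal δ := by
  have h : Tendsto (fun e : ℕ => (n : ENNReal) * (2⁻¹ : ENNReal) ^ e) atTop (nhds (n * 0)) :=
    ENNReal.Tendsto.const_mul (ENNReal.tendsto_pow_atTop_nhds_zero_of_lt_one (by simp))
      (Or.inr (ENNReal.natCast_ne_top n))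
  rw [mul_zero] at h
  obtain ⟨e, he, he'⟩ := ((h.eventually
    (gt_mem_nhds (ENNReal.ofReal_pos.2 hδ))).and (eventually_ge_atTop F₀)).exists
  refine ⟨e, he', le_of_eq_of_le ?_ he.le⟩
  congr 1
  rw [← ENNReal.inv_pow, ← pow_mul, add_mul, one_mul, pow_add,
    ENNReal.mul_inv (by simp) (by simp), ← mul_assoc, ENNReal.mul_inv_cancel (by simp) (by simp),
    one_mul, ENNReal.inv_pow]

/-- At large power a grid of `2 ^ r * 2 ^ r` points within the power budget carries nearly
`logb 2 P` bits per symbol, even after a code that corrects a fraction `1 / u` of errors. -/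
theorem eventually_exists_grid_size {ε C : ℝ} (hC : 0 < C) {u : ℕ}
    (hu : (u : ℝ) < (1 + ε) * (u - 2)) (hε : 0 < ε) :
    ∀ᶠ P : ℝ in atTop, ∃ r b : ℕ, (C * 2 ^ r) ^ 2 ≤ P ∧ 0 < b ∧ b + u + 4 * r ≤ 2 * r * u ∧
      u * Real.logb 2 P ≤ (1 + ε) * b := by
  have hu2 : (2 : ℝ) < u := by
    by_contra! h
    have : (u : ℝ) - 2 ≤ 0 := by linarith
    nlinarith [Nat.cast_nonneg (α := ℝ) u]
  have hu3 : 3 ≤ u := by exact_mod_cast hu2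
  set c : ℝ := Real.logb 2 C with hc
  set κ : ℝ := (1 + ε) * (u - 2) - u with hκ
  have hκ0 : 0 < κ := by linarith
  have hlog := Real.tendsto_logb_atTop (b := 2) (by norm_num)
  -- The first threshold gives `u ≤ r`, hence `0 < b`; the third lets the slack `κ * logb 2 P`
  -- absorb the losses from the constant `c`, from rounding and from the code.
  filter_upwards [hlog.eventually_ge_atTop (2 * (c + 1 + u)), hlog.eventually_gt_atTop 0,
    hlog.eventually_ge_atTop ((1 + ε) * (2 * (u - 2) * (c + 1) + u) / κ),
    eventually_gt_atTop 0] with P h1 h2 h3 hP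
  set x : ℝ := Real.logb 2 P / 2 with hx
  have hx' : Real.logb 2 P = 2 * x := by rw [hx]; ring
  rw [hx'] at h1 h2 h3 ⊢
  -- The largest `r` for which `C * 2 ^ r` is at most the amplitude `2 ^ x`, the square root of `P`.
  have hr1 : ((⌊x - c⌋₊ : ℕ) : ℝ) ≤ x - c := Nat.floor_le (by nlinarith [Nat.cast_nonneg (α := ℝ) u])
  have hr2 : x - c < (⌊x - c⌋₊ : ℕ) + 1 := Nat.lt_floor_add_one _
  set r := ⌊x - c⌋₊
  have hur : u ≤ r := by
    have : (u : ℝ) ≤ r := by linarith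
    exact_mod_cast this
  have hnat : u + 4 * r < 2 * r * u := by nlinarith
  refine ⟨r, 2 * r * u - (u + 4 * r), ?_, by omega, by omega, ?_⟩
  · have h4 : C * 2 ^ r ≤ 2 ^ x := by
      rw [← Real.rpow_logb (b := 2) (by norm_num) (by norm_num) hC, ← Real.rpow_natCast,
        ← Real.rpow_add (by norm_num)]
      exact Real.rpow_le_rpow_of_exponent_le (by norm_num) (by linarith)
    calc (C * 2 ^ r) ^ 2 ≤ ((2 : ℝ) ^ x) ^ 2 := by gcongr
      _ = (2 : ℝ) ^ (Real.logb 2 P) := by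
        rw [← Real.rpow_natCast, ← Real.rpow_mul (by norm_num), hx']; push_cast; ring_nf
      _ = P := Real.rpow_logb (by norm_num) (by norm_num) hP
  · rw [Nat.cast_sub hnat.le]
    push_cast
    rw [div_le_iff₀ hκ0] at h3
    have h5 : (x - c - 1) * (2 * (u - 2)) ≤ r * (2 * ((u : ℝ) - 2)) := by
      gcongr
      linarith
    have h6 : (1 + ε) * ((x - c - 1) * (2 * (u - 2)) - u) ≤
        (1 + ε) * (r * (2 * ((u : ℝ) - 2)) - u) := by gcongr
    have h7 : (1 + ε) * (2 * (r : ℝ) * u - (u + 4 * r)) =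
        (1 + ε) * (r * (2 * ((u : ℝ) - 2)) - u) := by ring
    rw [h7]
    refine le_trans ?_ h6
    rw [hκ] at h3
    nlinarith

/-- Linear one-shot schemes with one placement for all channels achieve their delay on the
Gaussian channel. -/
theorem achievesDelay_of_oneShotScheme {L K N S n : ℕ} {γ : Fin K → ℝ} (hS : 0 < S)
    (cached : Fin K → Finset (Fin N × Fin S))
    (hcached : ∀ k, ((cached k).card : ℝ) ≤ γ k * (N * S))
    (hscheme : ∀ h : Channel L K, h.Generic →
      ∃ σ : OneShotScheme h N γ S n, σ.cached = cached) :
    AchievesDelay L N γ (n / S) := by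
  refine ⟨packetPlacement cached hS hcached, fun h hh ε hε => ?_⟩
  obtain ⟨σ, rfl⟩ := hscheme h hh
  have hS' : (0 : ℝ) < S := by exact_mod_cast hS
  obtain ⟨V, hV0, hV⟩ : ∃ V : ℝ, 0 < V ∧
      ∀ d i, ∑ k ∈ σ.active d i, ‖σ.normalize.beam d i k‖ ≤ V := by
    refine ⟨1 + ∑ d, ∑ i, ∑ k ∈ σ.active d i, ‖σ.normalize.beam d i k‖, by positivity, ?_⟩
    intro d i
    have h1 := Finset.single_le_sum (f := fun i => ∑ k ∈ σ.active d i, ‖σ.normalize.beam d i k‖)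
      (fun i _ => by positivity) (Finset.mem_univ i)
    have h2 := Finset.single_le_sum
      (f := fun d => ∑ i, ∑ k ∈ σ.active d i, ‖σ.normalize.beam d i k‖)
      (fun i _ => by positivity) (Finset.mem_univ d)
    linarith
  -- Order of the choices: `V` depends on the channel and the scheme, `u` on `ε'`, the threshold `A`
  -- on `u`, the grid and `b` on `P`, and last the block parameter `e` on `δ` and `F₀`.
  set ε' : ℝ := ε * S / (n + 1) with hε'
  have hε'0 : 0 < ε' := by positivity
  have hnε : n * (1 + ε') ≤ n + ε * S := by
    have : ε' * (n + 1) = ε * S := by rw [hε']; field_simp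
    nlinarith
  obtain ⟨u, hu⟩ := exists_nat_gt (2 * (1 + ε') / ε')
  have hu' : (u : ℝ) < (1 + ε') * (u - 2) := by
    rw [div_lt_iff₀ hε'0] at hu
    nlinarith
  obtain ⟨A, hA, hAp⟩ := exists_measure_lt_norm_le complexGaussian
    (p := ((2 : ENNReal) ^ (u + 1))⁻¹) (by simp)
  filter_upwards [eventually_exists_grid_size (C := 6 * A * V) (by positivity) hu' hε'0]
    with P ⟨r, b, hP, hb0, hb, hrate⟩ δ hδ F₀
  obtain ⟨e, he, heδ⟩ := exists_pow_inv_le (n := n) (F₀ := F₀) u hδ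
  have hdiv : S * (b * e) / S = b * e := Nat.mul_div_cancel_left _ hS
  refine ⟨S * (b * e), ?_, n * (u * e), ?_, ?_⟩
  · calc F₀ ≤ e := he
      _ = 1 * (1 * e) := by ring
      _ ≤ S * (b * e) := Nat.mul_le_mul hS (Nat.mul_le_mul hb0 le_rfl)
  · push_cast
    calc (n : ℝ) * (u * e) * Real.logb 2 P = n * e * (u * Real.logb 2 P) := by ring
      _ ≤ n * e * ((1 + ε') * b) := by gcongr
      _ = n * (1 + ε') * (b * e) := by ring
      _ ≤ (n + ε * S) * (b * e) := by gcongr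
      _ = (n / S + ε) * (S * (b * e)) := by field_simp
  · obtain ⟨c⟩ := exists_linkCode u e r b hA hb
    rw [← hdiv] at c
    refine σ.normalize.nonempty_delivery hS (fun d i k hk => σ.inner_beam_normalize d i hk) hV
      (by rw [hdiv]) (by positivity) c ?_ hAp heδ
    calc (6 * A * 2 ^ r * V) ^ 2 = (6 * A * V * 2 ^ r) ^ 2 := by ring
      _ ≤ P := hP

/-! ### Zero-forcing and schedules -/

/-- By independence `h j` lies outside the span of the channels in `B`, so it is not orthogonal to
the whole orthogonal complement of that span. -/
theorem Channel.Generic.exists_beam {L K : ℕ} {h : Channel L K} (hh : h.Generic)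
    {B : Finset (Fin K)} {j : Fin K} (hj : j ∉ B) (hB : B.card < L) :
    ∃ v, inner ℂ (h j) v ≠ 0 ∧ ∀ k ∈ B, inner ℂ (h k) v = 0 := by
  classical
  have hli := hh (insert j B) (by rw [Finset.card_insert_of_notMem hj]; omega)
  set U := Submodule.span ℂ (h '' (B : Set (Fin K))) with hU
  have hnot : h j ∉ U := by
    have hli' : LinearIndepOn ℂ h ((insert j B : Finset (Fin K)) : Set (Fin K)) := hli
    rw [Finset.coe_insert] at hli'
    exact ((linearIndepOn_insert (by simpa using hj)).1 hli').2
  rw [← Submodule.orthogonal_orthogonal U, Submodule.mem_orthogonal] at hnot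
  push Not at hnot
  obtain ⟨v, hv, hv'⟩ := hnot
  refine ⟨v, fun h0 => hv' (inner_eq_zero_symm.1 h0), fun k hk => ?_⟩
  exact (Submodule.mem_orthogonal U v).1 hv _ (Submodule.subset_span ⟨k, hk, rfl⟩)

/-- Numbers the occasions on which a user is served with a class, so that each of the `m` packets of
the class gets a turn. -/
theorem Finset.exists_forall_exists_eq_of_le_card {ι : Type*} {s : Finset ι} {m : ℕ} (hm : 0 < m)
    (hs : m ≤ s.card) : ∃ f : ι → Fin m, ∀ j, ∃ i ∈ s, f i = j := by
  obtain ⟨g⟩ : Nonempty (Fin m ↪ s) :=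
    Function.Embedding.nonempty_of_card_le (by simpa using hs)
  have : Nonempty (Fin m) := ⟨⟨0, hm⟩⟩
  let g' : Fin m → ι := fun j => g j
  have hg' : Function.Injective g' := Subtype.val_injective.comp g.injective
  exact ⟨Function.invFun g', fun j => ⟨g' j, (g j).2, Function.leftInverse_invFun hg' j⟩⟩

/-- A schedule assigns to every slot a set of active users and to every active user a class of
packets. A class is cached at a given set of users. If the packet of every active user is missing
at fewer than `L` of the other active users, and every user is served `m` times with every class
that it does not cache, then the schedule is realized by a linear one-shot scheme with `m` packets
of every class in every file. -/
theorem exists_oneShotScheme_of_schedule {L K N m : ℕ} {γ : Fin K → ℝ} {U ι Θ : Type*}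
    [DecidableEq U] [Fintype ι] [Fintype Θ] [DecidableEq Θ] (e : U ≃ Fin K)
    (act : ι → Finset U) (cls : ι → U → Θ) (cach : Θ → Finset U)
    (hnull : ∀ i, ∀ u ∈ act i, ((act i).erase u \ cach (cls i u)).card < L) (hm : 0 < m)
    (hcover : ∀ u θ, u ∉ cach θ →
      m ≤ (Finset.univ.filter fun i => u ∈ act i ∧ cls i u = θ).card)
    (hγ : ∀ u, ((Finset.univ.filter fun θ => u ∈ cach θ).card : ℝ) ≤ γ (e u) * Fintype.card Θ) :
    ∃ cached : Fin K → Finset (Fin N × Fin (Fintype.card Θ * m)),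
      (∀ k, ((cached k).card : ℝ) ≤ γ k * (N * (Fintype.card Θ * m : ℕ))) ∧
      ∀ h : Channel L K, h.Generic →
        ∃ σ : OneShotScheme h N γ (Fintype.card Θ * m) (Fintype.card ι), σ.cached = cached := by
  classical
  let eι := Fintype.equivFin ι
  let eS : Θ × Fin m ≃ Fin (Fintype.card Θ * m) :=
    ((Fintype.equivFin Θ).prodCongr (Equiv.refl _)).trans finProdFinEquiv
  have hidx : ∀ u θ, ∃ f : ι → Fin m, u ∉ cach θ → ∀ j, ∃ i, (u ∈ act i ∧ cls i u = θ) ∧ f i = j := by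
    intro u θ
    by_cases hu : u ∈ cach θ
    · exact ⟨fun _ => ⟨0, hm⟩, fun h => absurd hu h⟩
    · obtain ⟨f, hf⟩ := Finset.exists_forall_exists_eq_of_le_card hm (hcover u θ hu)
      exact ⟨f, fun _ j => by simpa using hf j⟩
  choose idx hidx using hidx
  -- All files are cached alike, by class, so neither the channel nor the demands enter.
  let cached : Fin K → Finset (Fin N × Fin (Fintype.card Θ * m)) := fun k =>
    Finset.univ.filter fun p => e.symm k ∈ cach (eS.symm p.2).1
  have hcard : ∀ k, ((cached k).card : ℝ) ≤ γ k * (N * (Fintype.card Θ * m : ℕ)) := by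
    intro k
    have : (cached k).card =
        N * ((Finset.univ.filter fun θ => e.symm k ∈ cach θ).card * m) := by
      trans ((Finset.univ : Finset (Fin N)) ×ˢ
        (Finset.univ.filter fun θ => e.symm k ∈ cach θ) ×ˢ (Finset.univ : Finset (Fin m))).card
      swap
      · simp only [Finset.card_product, Finset.card_univ, Fintype.card_fin]
      refine Finset.card_bij' (fun p _ => (p.1, eS.symm p.2)) (fun p _ => (p.1, eS p.2)) ?_ ?_ ?_ ?_
      · intro p hp
        simpa [cached] using hp
      · intro p hp
        simpa [cached] using hp
      · intro p _
        simp
      · intro p _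
        simp
    rw [this]
    have := hγ (e.symm k)
    rw [Equiv.apply_symm_apply] at this
    push_cast
    calc (N : ℝ) * ((Finset.univ.filter fun θ => e.symm k ∈ cach θ).card * m) ≤
        N * (γ k * Fintype.card Θ * m) := by gcongr
      _ = _ := by ring
  refine ⟨cached, hcard, fun h hh => ?_⟩
  have hbeam : ∀ i u, ∃ v, u ∈ act i → inner ℂ (h (e u)) v ≠ 0 ∧
      ∀ w ∈ (act i).erase u \ cach (cls i u), inner ℂ (h (e w)) v = 0 := by
    intro i u
    by_cases hu : u ∈ act i
    · obtain ⟨v, hv, hv'⟩ := hh.exists_beam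
        (B := ((act i).erase u \ cach (cls i u)).map e.toEmbedding) (j := e u)
        (by simp) (by rw [Finset.card_map]; exact hnull i u hu)
      exact ⟨v, fun _ => ⟨hv, fun w hw => hv' _ (Finset.mem_map_of_mem _ hw)⟩⟩
    · exact ⟨0, fun h => absurd h hu⟩
  choose beam hbeam using hbeam
  refine ⟨{ cached := cached
            cached_le := hcard
            active := fun _ i => (act (eι.symm i)).map e.toEmbedding
            packet := fun _ i k => eS (cls (eι.symm i) (e.symm k),
              idx (e.symm k) (cls (eι.symm i) (e.symm k)) (eι.symm i))
            beam := fun _ i k => beam (eι.symm i) (e.symm k)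
            desired := ?_
            interference := ?_
            complete := ?_ }, rfl⟩
  · intro d i k hk
    obtain ⟨u, hu, rfl⟩ := Finset.mem_map.1 hk
    simpa using (hbeam _ u hu).1
  · intro d i k hk j hj hjk
    obtain ⟨u, hu, rfl⟩ := Finset.mem_map.1 hk
    obtain ⟨w, hw, rfl⟩ := Finset.mem_map.1 hj
    have huw : u ≠ w := fun h => hjk (by rw [h])
    by_cases hc : u ∈ cach (cls (eι.symm i) w)
    · left
      simpa [cached] using hc
    · right
      simpa using (hbeam _ w hw).2 u (by simp [huw, hu, hc])
  · intro d k s hs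
    have hs' : e.symm k ∉ cach (eS.symm s).1 := by simpa [cached] using hs
    obtain ⟨i, ⟨hi, hcls⟩, hf⟩ := hidx _ _ hs' (eS.symm s).2
    refine ⟨eι i, ?_, ?_⟩
    · rw [Equiv.symm_apply_apply]
      exact Finset.mem_map.2 ⟨_, hi, by simp⟩
    · rw [Equiv.symm_apply_apply, hcls, hf, Prod.mk.eta, Equiv.apply_symm_apply]

/-! ### Symmetrization over permutations of the users -/

/-- Translates of a family of pairs `(u, c u)`, `u ∈ A`, under a group hit all elements of an
orbit `O` of pairs equally often. -/
theorem card_orbit_mul_card_hits {G U Θ : Type*} [Group G] [Fintype G] [DecidableEq U]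
    [DecidableEq Θ] (ρ : G →* Equiv.Perm U) (π : G →* Equiv.Perm Θ) (O : Finset (U × Θ))
    (hinv : ∀ g, ∀ x ∈ O, (ρ g x.1, π g x.2) ∈ O)
    (htrans : ∀ x ∈ O, ∀ y ∈ O, ∃ g, (ρ g x.1, π g x.2) = y)
    (A : Finset U) (c : U → Θ) {x : U × Θ} (hx : x ∈ O) :
    O.card * (Finset.univ.filter fun g =>
      (ρ g).symm x.1 ∈ A ∧ π g (c ((ρ g).symm x.1)) = x.2).card =
    (A.filter fun u => (u, c u) ∈ O).card * Fintype.card G := by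
  have hinvρ : ∀ g u, ρ g⁻¹ (ρ g u) = u := fun g u => by
    rw [← Equiv.Perm.mul_apply, ← map_mul, inv_mul_cancel, map_one, Equiv.Perm.one_apply]
  have hinvπ : ∀ g u, π g⁻¹ (π g u) = u := fun g u => by
    rw [← Equiv.Perm.mul_apply, ← map_mul, inv_mul_cancel, map_one, Equiv.Perm.one_apply]
  let hits : U × Θ → Finset G := fun x => Finset.univ.filter fun g =>
      (ρ g).symm x.1 ∈ A ∧ π g (c ((ρ g).symm x.1)) = x.2
  -- Left multiplication by `g₀` maps the hits of `x` bijectively onto those of its translate.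
  have hconst : ∀ y ∈ O, (hits y).card = (hits x).card := by
    intro y hy
    obtain ⟨g₀, rfl⟩ := htrans x hx y hy
    symm
    refine Finset.card_bij (fun g _ => g₀ * g) ?_ (fun _ _ _ _ h => mul_left_cancel h) ?_
    · intro g hg
      simp only [hits, Finset.mem_filter, Finset.mem_univ, true_and] at hg ⊢
      have h1 : (ρ (g₀ * g)).symm (ρ g₀ x.1) = (ρ g).symm x.1 := by
        rw [Equiv.symm_apply_eq, map_mul, Equiv.Perm.mul_apply, Equiv.apply_symm_apply]
      rw [h1, map_mul, Equiv.Perm.mul_apply, hg.2]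
      exact ⟨hg.1, rfl⟩
    · intro g hg
      refine ⟨g₀⁻¹ * g, ?_, mul_inv_cancel_left _ _⟩
      simp only [hits, Finset.mem_filter, Finset.mem_univ, true_and] at hg ⊢
      have h1 : (ρ (g₀⁻¹ * g)).symm x.1 = (ρ g).symm (ρ g₀ x.1) := by
        rw [Equiv.symm_apply_eq, map_mul, Equiv.Perm.mul_apply, Equiv.apply_symm_apply, hinvρ]
      rw [h1, map_mul, Equiv.Perm.mul_apply, hg.2, hinvπ]
      exact ⟨hg.1, rfl⟩
  -- Double count of pairs of an orbit element and a group element that hits it; each translate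
  -- meets the invariant set `O` as often as the original family does.
  have hswap := Finset.sum_card_bipartiteAbove_eq_sum_card_bipartiteBelow
    (s := O) (t := (Finset.univ : Finset G))
    (fun y g => (ρ g).symm y.1 ∈ A ∧ π g (c ((ρ g).symm y.1)) = y.2)
  have hleft : ∑ y ∈ O, (hits y).card = O.card * (hits x).card := by
    rw [Finset.sum_congr rfl hconst, Finset.sum_const, smul_eq_mul]
  have hright : ∀ g, (O.filter fun y =>
      (ρ g).symm y.1 ∈ A ∧ π g (c ((ρ g).symm y.1)) = y.2).card =
      (A.filter fun u => (u, c u) ∈ O).card := by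
    intro g
    symm
    refine Finset.card_bij (fun u _ => (ρ g u, π g (c u))) ?_ ?_ ?_
    · intro u hu
      rw [Finset.mem_filter] at hu ⊢
      exact ⟨hinv g _ hu.2, by simpa using hu.1⟩
    · intro u _ v _ huv
      exact (ρ g).injective (Prod.ext_iff.1 huv).1
    · rintro ⟨v, θ⟩ hv
      rw [Finset.mem_filter] at hv
      obtain ⟨hO, hA, hθ⟩ := hv
      have hback := hinv g⁻¹ _ hO
      simp only at hA hθ hback
      refine ⟨(ρ g).symm v, ?_, by simp [hθ]⟩
      rw [Finset.mem_filter]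
      refine ⟨hA, ?_⟩
      rw [← hθ, hinvπ] at hback
      have h1 : ρ g⁻¹ v = (ρ g).symm v := by
        rw [← hinvρ g ((ρ g).symm v), Equiv.apply_symm_apply]
      rwa [h1] at hback
  rw [← hleft]
  refine hswap.trans ?_
  refine (Finset.sum_congr rfl fun g _ => hright g).trans ?_
  rw [Finset.sum_const, Finset.card_univ, smul_eq_mul,
    mul_comm]

/-- The action of permutations on finite sets. -/
def finsetPerm (α : Type*) : Equiv.Perm α →* Equiv.Perm (Finset α) where
  toFun := Equiv.finsetCongr
  map_one' := Equiv.ext fun _ => Finset.map_refl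
  map_mul' g h := Equiv.ext fun s => (Finset.map_map h.toEmbedding g.toEmbedding s).symm

theorem exists_perm_map_finset_eq {α : Type*} [Finite α] [DecidableEq α] {s t : Finset α}
    (hst : s.card = t.card) : ∃ g : Equiv.Perm α, s.map g.toEmbedding = t := by
  have e : {x // x ∈ s} ≃ {x // x ∈ t} := Finset.equivOfCardEq hst
  refine ⟨e.extendSubtype, Finset.eq_of_subset_of_card_le ?_ (by rw [Finset.card_map, hst])⟩
  intro x hx
  obtain ⟨y, hy, rfl⟩ := Finset.mem_map.1 hx
  exact e.extendSubtype_mem y hy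

theorem exists_perm_map_finset_eq_and_apply_eq {α : Type*} [Finite α] [DecidableEq α]
    {s t : Finset α} (hst : s.card = t.card) {a b : α} (ha : a ∉ s) (hb : b ∉ t) :
    ∃ g : Equiv.Perm α, s.map g.toEmbedding = t ∧ g a = b := by
  obtain ⟨g, rfl⟩ := exists_perm_map_finset_eq hst
  -- The swap fixes the image of `s` pointwise, as neither `g a` nor `b` lies in it.
  refine ⟨Equiv.swap (g a) b * g, ?_, by simp⟩
  ext x
  simp only [Finset.mem_map, Equiv.coe_toEmbedding, Equiv.Perm.coe_mul, Function.comp_apply]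
  refine exists_congr fun y => and_congr_right fun hy => ?_
  rw [Equiv.swap_apply_of_ne_of_ne]
  · exact fun h => ha (g.injective h ▸ hy)
  · rintro rfl
    exact hb (Finset.mem_map_of_mem _ hy)

/-- Parts that differ by at most one, so that integer bounds on the average `M / D` hold for each
part. -/
theorem exists_balanced_sum {D : ℕ} (hD : 0 < D) (M : ℕ) :
    ∃ a : Fin D → ℕ, ∑ x, a x = M ∧
      ∀ x, (∀ b, D * b ≤ M → b ≤ a x) ∧ (∀ b, M ≤ D * b → a x ≤ b) := by
  refine ⟨fun x => M / D + if (x : ℕ) < M % D then 1 else 0, ?_, fun x => ⟨fun b hb => ?_,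
    fun b hb => ?_⟩⟩
  · rw [Finset.sum_add_distrib, Finset.sum_const, Finset.card_univ, Fintype.card_fin, smul_eq_mul,
      Fin.sum_univ_eq_sum_range (fun x => if x < M % D then 1 else 0) D, ← Finset.sum_filter,
      Finset.sum_const, smul_eq_mul, mul_one]
    have : (Finset.range D).filter (fun x => x < M % D) = Finset.range (M % D) := by
      ext x
      simp only [Finset.mem_filter, Finset.mem_range]
      have := Nat.mod_lt M hD
      omega
    rw [this, Finset.card_range, Nat.div_add_mod]
  · have : b ≤ M / D := (Nat.le_div_iff_mul_le hD).2 ((mul_comm b D).le.trans hb)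
    exact this.trans (Nat.le_add_right _ _)
  · have h1 : M / D ≤ b := Nat.div_le_of_le_mul hb
    simp only
    split_ifs with hx
    · by_contra! hlt
      have h2 : M / D = b := by omega
      have h3 := Nat.div_add_mod M D
      rw [h2] at h3
      omega
    · omega

/-- A base group of `q` active users, `a` of them caching. The class `c u` consists of `t` active
caching users other than `u`; avoiding `u` is why `t + 1 ≤ a` is needed. -/
theorem exists_user_group {K₁ K₂ t q a : ℕ} (hta : t + 1 ≤ a) (ha : a ≤ K₁) (haq : a ≤ q)
    (hq : q ≤ K₂ + a) :
    ∃ (A : Finset (Fin K₁ ⊕ Fin K₂)) (c : Fin K₁ ⊕ Fin K₂ → Finset (Fin K₁)),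
      (∀ u, (c u).card = t) ∧ (∀ u, (c u).map Function.Embedding.inl ⊆ A) ∧
      (∀ k, k ∉ c (Sum.inl k)) ∧ A.card = q ∧ (A.filter fun u => u.isLeft).card = a := by
  classical
  obtain ⟨A₁, -, hA₁⟩ := Finset.exists_subset_card_eq (s := (Finset.univ : Finset (Fin K₁)))
    (n := a) (by simpa using ha)
  obtain ⟨B, -, hB⟩ := Finset.exists_subset_card_eq (s := (Finset.univ : Finset (Fin K₂)))
    (n := q - a) (by simpa using by omega)
  have hc : ∀ u : Fin K₁ ⊕ Fin K₂, ∃ τ ⊆ A₁, τ.card = t ∧ ∀ k, u = Sum.inl k → k ∉ τ := by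
    rintro (k | k)
    · obtain ⟨τ, hτ, hcard⟩ := Finset.exists_subset_card_eq (s := A₁.erase k) (n := t) (by
        have := Finset.pred_card_le_card_erase (s := A₁) (a := k)
        omega)
      refine ⟨τ, hτ.trans (Finset.erase_subset _ _), hcard, ?_⟩
      rintro _ ⟨⟩ hk
      simpa using hτ hk
    · obtain ⟨τ, hτ, hcard⟩ := Finset.exists_subset_card_eq (s := A₁) (n := t) (by omega)
      exact ⟨τ, hτ, hcard, by simp⟩
  choose c hcA hct hck using hc
  refine ⟨A₁.disjSum B, c, hct, fun u => ?_, fun k => hck _ k rfl, ?_, ?_⟩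
  · intro v hv
    obtain ⟨k, hk, rfl⟩ := Finset.mem_map.1 hv
    simpa using hcA u hk
  · rw [Finset.card_disjSum, hA₁, hB]
    omega
  · have : (A₁.disjSum B).filter (fun u => u.isLeft) = A₁.map Function.Embedding.inl := by
      ext u
      rcases u with k | k <;> simp
    rw [this, Finset.card_map, hA₁]

/-- The memory count of the placement: a caching user stores the fraction `t / K` of the classes.
The `t`-sets that avoid `k` are counted instead. -/
theorem card_mul_card_subtype_mem {K t : ℕ} (k : Fin K) :
    K * (Finset.univ.filter fun θ : {τ : Finset (Fin K) // τ.card = t} => k ∈ θ.1).card =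
      t * K.choose t := by
  classical
  have h1 : (Finset.univ.filter fun θ : {τ : Finset (Fin K) // τ.card = t} => k ∉ θ.1).card =
      (K - 1).choose t := by
    have h2 : (Finset.powersetCard t ((Finset.univ : Finset (Fin K)).erase k)).card =
        (K - 1).choose t := by
      rw [Finset.card_powersetCard, Finset.card_erase_of_mem (Finset.mem_univ k),
        Finset.card_univ, Fintype.card_fin]
    rw [← h2]
    refine Finset.card_bij (fun θ _ => θ.1) ?_ (fun _ _ _ _ h => Subtype.ext h) ?_
    · intro θ hθ
      simp only [Finset.mem_filter, Finset.mem_univ, true_and] at hθ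
      exact Finset.mem_powersetCard.2 ⟨fun x hx =>
        Finset.mem_erase.2 ⟨fun h => hθ (h ▸ hx), Finset.mem_univ _⟩, θ.2⟩
    · intro τ hτ
      obtain ⟨hτ, hcard⟩ := Finset.mem_powersetCard.1 hτ
      exact ⟨⟨τ, hcard⟩, by simpa using fun h => by simpa using hτ h, rfl⟩
  have h3 := Finset.card_filter_add_card_filter_not (s := Finset.univ)
    (fun θ : {τ : Finset (Fin K) // τ.card = t} => k ∈ θ.1)
  rw [h1, Finset.card_univ, Fintype.card_finset_len, Fintype.card_fin] at h3
  obtain ⟨K', rfl⟩ : ∃ K', K = K' + 1 := ⟨K - 1, by have := k.2; omega⟩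
  have h4 := Nat.choose_mul_succ_eq K' t
  rw [Nat.add_sub_cancel] at h3
  rcases le_or_gt t (K' + 1) with ht | ht
  · obtain ⟨r, hr⟩ := Nat.exists_eq_add_of_le ht
    rw [hr, Nat.add_sub_cancel_left, ← hr] at h4
    have h5 : (K' + 1) * (K' + 1).choose t = t * (K' + 1).choose t + (K' + 1).choose t * r := by
      rw [mul_comm _ r, ← add_mul, ← hr]
    nlinarith
  · rw [Nat.choose_eq_zero_of_lt ht] at h3 ⊢
    simp only [Nat.add_eq_zero_iff] at h3
    rw [h3.1, mul_zero, mul_zero]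

section TwoType

variable (K₁ K₂ t : ℕ)

/-- Pairs of a caching user and a `t`-set of caching users without it. -/
def cachingPairs : Finset ((Fin K₁ ⊕ Fin K₂) × Finset (Fin K₁)) :=
  Finset.univ.filter fun x => x.2.card = t ∧ ∃ k, x.1 = Sum.inl k ∧ k ∉ x.2

/-- Pairs of a cache-less user and a `t`-set of caching users. -/
def cachelessPairs : Finset ((Fin K₁ ⊕ Fin K₂) × Finset (Fin K₁)) :=
  Finset.univ.filter fun x => x.2.card = t ∧ ∃ k, x.1 = Sum.inr k

theorem card_cachingPairs : (cachingPairs K₁ K₂ t).card = K₁.choose t * (K₁ - t) := by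
  have : ((Finset.powersetCard t (Finset.univ : Finset (Fin K₁))).sigma fun τ => τᶜ).card =
      K₁.choose t * (K₁ - t) := by
    rw [Finset.card_sigma, Finset.sum_congr rfl (g := fun _ => K₁ - t), Finset.sum_const,
      Finset.card_powersetCard, Finset.card_univ, Fintype.card_fin, smul_eq_mul]
    intro τ hτ
    rw [Finset.card_compl, Fintype.card_fin, (Finset.mem_powersetCard.1 hτ).2]
  rw [← this]
  symm
  refine Finset.card_bij (fun x _ => (Sum.inl x.2, x.1)) ?_ ?_ ?_
  · rintro ⟨τ, k⟩ hx
    simpa [cachingPairs] using hx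
  · rintro ⟨τ, k⟩ _ ⟨τ', k'⟩ _ h
    simp only [Prod.mk.injEq, Sum.inl.injEq] at h
    obtain ⟨rfl, rfl⟩ := h
    rfl
  · rintro ⟨u, τ⟩ hx
    simp only [cachingPairs, Finset.mem_filter, Finset.mem_univ, true_and] at hx
    obtain ⟨hτ, k, rfl, hk⟩ := hx
    exact ⟨⟨τ, k⟩, by simp [hτ, hk], rfl⟩

theorem card_cachelessPairs : (cachelessPairs K₁ K₂ t).card = K₁.choose t * K₂ := by
  have : ((Finset.powersetCard t (Finset.univ : Finset (Fin K₁))) ×ˢ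
      (Finset.univ : Finset (Fin K₂))).card = K₁.choose t * K₂ := by
    rw [Finset.card_product, Finset.card_powersetCard, Finset.card_univ, Fintype.card_fin,
      Finset.card_univ, Fintype.card_fin]
  rw [← this]
  symm
  refine Finset.card_bij (fun x _ => (Sum.inr x.2, x.1)) ?_ ?_ ?_
  · rintro ⟨τ, k⟩ hx
    simpa [cachelessPairs] using hx
  · rintro ⟨τ, k⟩ _ ⟨τ', k'⟩ _ h
    simp only [Prod.mk.injEq, Sum.inr.injEq] at h
    obtain ⟨rfl, rfl⟩ := h
    rfl
  · rintro ⟨u, τ⟩ hx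
    simp only [cachelessPairs, Finset.mem_filter, Finset.mem_univ, true_and] at hx
    obtain ⟨hτ, k, rfl⟩ := hx
    exact ⟨⟨τ, k⟩, by simp [hτ], rfl⟩

/-- The symmetries of a system with two types of users. -/
abbrev TypePerm : Type := Equiv.Perm (Fin K₁) × Equiv.Perm (Fin K₂)

/-- The action of the symmetries on the users. -/
def userPerm : TypePerm K₁ K₂ →* Equiv.Perm (Fin K₁ ⊕ Fin K₂) :=
  Equiv.Perm.sumCongrHom _ _

/-- The action of the symmetries on sets of caching users. -/
def cachingSetPerm : TypePerm K₁ K₂ →* Equiv.Perm (Finset (Fin K₁)) :=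
  (finsetPerm (Fin K₁)).comp (MonoidHom.fst _ _)

variable {K₁ K₂ t}

theorem cachingSetPerm_apply (g : TypePerm K₁ K₂) (τ : Finset (Fin K₁)) :
    cachingSetPerm K₁ K₂ g τ = τ.map g.1.toEmbedding := rfl

theorem userPerm_inl (g : TypePerm K₁ K₂) (k : Fin K₁) :
    userPerm K₁ K₂ g (Sum.inl k) = Sum.inl (g.1 k) := rfl

theorem userPerm_inr (g : TypePerm K₁ K₂) (k : Fin K₂) :
    userPerm K₁ K₂ g (Sum.inr k) = Sum.inr (g.2 k) := rfl

theorem mem_cachingPairs {x : (Fin K₁ ⊕ Fin K₂) × Finset (Fin K₁)} :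
    x ∈ cachingPairs K₁ K₂ t ↔ x.2.card = t ∧ ∃ k, x.1 = Sum.inl k ∧ k ∉ x.2 := by
  simp [cachingPairs]

theorem mem_cachelessPairs {x : (Fin K₁ ⊕ Fin K₂) × Finset (Fin K₁)} :
    x ∈ cachelessPairs K₁ K₂ t ↔ x.2.card = t ∧ ∃ k, x.1 = Sum.inr k := by
  simp [cachelessPairs]

/-- These pairs form a single orbit, and by `hc` every caching user of the group contributes one of
them. -/
theorem card_cachingPairs_mul_card_hits {A : Finset (Fin K₁ ⊕ Fin K₂)}
    {c : Fin K₁ ⊕ Fin K₂ → Finset (Fin K₁)} (hct : ∀ u, (c u).card = t)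
    (hc : ∀ k, k ∉ c (Sum.inl k)) {k : Fin K₁} {τ : Finset (Fin K₁)} (hτ : τ.card = t)
    (hk : k ∉ τ) :
    K₁.choose t * (K₁ - t) * (Finset.univ.filter fun g => (userPerm K₁ K₂ g).symm (Sum.inl k) ∈ A ∧
      cachingSetPerm K₁ K₂ g (c ((userPerm K₁ K₂ g).symm (Sum.inl k))) = τ).card =
    (A.filter fun u => u.isLeft).card * Fintype.card (TypePerm K₁ K₂) := by
  classical
  have hx : ((Sum.inl k : Fin K₁ ⊕ Fin K₂), τ) ∈ cachingPairs K₁ K₂ t :=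
    mem_cachingPairs.2 ⟨hτ, k, rfl, hk⟩
  have h := card_orbit_mul_card_hits (userPerm K₁ K₂) (cachingSetPerm K₁ K₂)
    (cachingPairs K₁ K₂ t) ?_ ?_ A c hx
  · rw [card_cachingPairs] at h
    refine h.trans ?_
    congr 2
    refine Finset.filter_congr fun u _ => ?_
    rw [mem_cachingPairs]
    rcases u with u | u
    · simp [hct, hc]
    · simp
  · rintro g ⟨u, τ⟩ hx
    obtain ⟨h1, k, rfl, hk⟩ := mem_cachingPairs.1 hx
    refine mem_cachingPairs.2 ⟨by rw [cachingSetPerm_apply, Finset.card_map]; exact h1, g.1 k, rfl, ?_⟩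
    simpa [cachingSetPerm_apply] using hk
  · rintro ⟨u, τ⟩ hx ⟨v, τ'⟩ hy
    obtain ⟨h1, k, rfl, hk⟩ := mem_cachingPairs.1 hx
    obtain ⟨h1', k', rfl, hk'⟩ := mem_cachingPairs.1 hy
    simp only at h1 h1' hk hk'
    obtain ⟨g, hg, hgk⟩ := exists_perm_map_finset_eq_and_apply_eq (h1.trans h1'.symm) hk hk'
    exact ⟨(g, 1), by simp [userPerm_inl, cachingSetPerm_apply, hg, hgk]⟩

theorem card_cachelessPairs_mul_card_hits {A : Finset (Fin K₁ ⊕ Fin K₂)}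
    {c : Fin K₁ ⊕ Fin K₂ → Finset (Fin K₁)} (hct : ∀ u, (c u).card = t) {k : Fin K₂}
    {τ : Finset (Fin K₁)} (hτ : τ.card = t) :
    K₁.choose t * K₂ * (Finset.univ.filter fun g => (userPerm K₁ K₂ g).symm (Sum.inr k) ∈ A ∧
      cachingSetPerm K₁ K₂ g (c ((userPerm K₁ K₂ g).symm (Sum.inr k))) = τ).card =
    (A.filter fun u => ¬ u.isLeft).card * Fintype.card (TypePerm K₁ K₂) := by
  classical
  have hx : ((Sum.inr k : Fin K₁ ⊕ Fin K₂), τ) ∈ cachelessPairs K₁ K₂ t :=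
    mem_cachelessPairs.2 ⟨hτ, k, rfl⟩
  have h := card_orbit_mul_card_hits (userPerm K₁ K₂) (cachingSetPerm K₁ K₂)
    (cachelessPairs K₁ K₂ t) ?_ ?_ A c hx
  · rw [card_cachelessPairs] at h
    refine h.trans ?_
    congr 2
    refine Finset.filter_congr fun u _ => ?_
    rw [mem_cachelessPairs]
    rcases u with u | u <;> simp [hct]
  · rintro g ⟨u, τ⟩ hx
    obtain ⟨h1, k, rfl⟩ := mem_cachelessPairs.1 hx
    exact mem_cachelessPairs.2 ⟨by rw [cachingSetPerm_apply, Finset.card_map]; exact h1, g.2 k, rfl⟩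
  · rintro ⟨u, τ⟩ hx ⟨v, τ'⟩ hy
    obtain ⟨h1, k, rfl⟩ := mem_cachelessPairs.1 hx
    obtain ⟨h1', k', rfl⟩ := mem_cachelessPairs.1 hy
    simp only at h1 h1'
    obtain ⟨g, hg⟩ := exists_perm_map_finset_eq (h1.trans h1'.symm)
    exact ⟨(g, Equiv.swap k k'), by simp [userPerm_inr, cachingSetPerm_apply, hg]⟩

end TwoType

/-! ### The scheme for caching and cache-less users -/

/-- Counting the triples that satisfy a condition on the first and the last entry only. -/
theorem card_hits_of_product {X C G : Type*} [Fintype X] [Fintype C] [Fintype G]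
    (P : X → G → Prop) [∀ x, DecidablePred (P x)] :
    (Finset.univ.filter fun i : (X × C) × G => P i.1.1 i.2).card =
      Fintype.card C * ∑ x, (Finset.univ.filter (P x)).card := by
  classical
  simp only [Finset.card_filter]
  rw [Fintype.sum_prod_type, Fintype.sum_prod_type, Finset.mul_sum]
  simp

theorem card_users_mem_twoType {K₁ K₂ t : ℕ} {γ₁ : ℝ} (hγ : (K₁ : ℝ) * γ₁ = t)
    (u : Fin K₁ ⊕ Fin K₂) :
    ((Finset.univ.filter fun θ : {τ : Finset (Fin K₁) // τ.card = t} =>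
      u ∈ (θ.1.map Function.Embedding.inl : Finset (Fin K₁ ⊕ Fin K₂))).card : ℝ) ≤
      twoTypeCaches K₁ K₂ γ₁ (finSumFinEquiv u) *
        Fintype.card {τ : Finset (Fin K₁) // τ.card = t} := by
  rcases u with k | k
  · have hK : (0 : ℝ) < K₁ := by exact_mod_cast k.pos
    have h := card_mul_card_subtype_mem (t := t) k
    have h' : (K₁ : ℝ) * (Finset.univ.filter fun θ : {τ : Finset (Fin K₁) // τ.card = t} =>
        k ∈ θ.1).card = t * K₁.choose t := by exact_mod_cast h
    rw [← hγ, mul_assoc] at h'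
    have h2 := mul_left_cancel₀ hK.ne' h'
    simp [twoTypeCaches, h2]
  · simp [twoTypeCaches]

/-- Caching and cache-less users are served together with full multiplexing and full coded
caching gains: `t` caching users know the packet of any active user, and it is nulled out at the
`L - 1` others. -/
theorem exists_oneShotScheme_twoType {L K₁ K₂ t D : ℕ} (N : ℕ) {γ₁ : ℝ} (hL : 1 ≤ L)
    (hγ : (K₁ : ℝ) * γ₁ = t) (ht : t < K₁) (hD : D + t = K₁ + K₂)
    (hgroup : D * (t + 1) ≤ (K₁ - t) * (L + t)) (hcaching : (K₁ - t) * (L + t) ≤ D * K₁)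
    (hcacheless : 0 < K₂ → L + t ≤ D) :
    ∃ S n : ℕ, 0 < S ∧ (n : ℝ) / S = D / (L + t) ∧
      ∃ cached : Fin (K₁ + K₂) → Finset (Fin N × Fin S),
        (∀ k, ((cached k).card : ℝ) ≤ twoTypeCaches K₁ K₂ γ₁ k * (N * S)) ∧
        ∀ h : Channel L (K₁ + K₂), h.Generic →
          ∃ σ : OneShotScheme h N (twoTypeCaches K₁ K₂ γ₁) S n, σ.cached = cached := by
  classical
  have hD0 : 0 < D := by omega
  have hC : 0 < K₁.choose t := Nat.choose_pos ht.le
  -- Group `x` has `a x` caching users. The total is their share `(K₁ - t) / D` of all `D * (L + t)`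
  -- places, since caching users together need `K₁ - t` of the `D` files' worth of data.
  obtain ⟨a, hasum, ha⟩ := exists_balanced_sum hD0 ((K₁ - t) * (L + t))
  obtain ⟨s, hs⟩ : ∃ s, K₁ = t + s := Nat.exists_eq_add_of_le ht.le
  have hs' : K₁ - t = s := by omega
  have hDs : D = s + K₂ := by omega
  have haq : ∀ x, a x ≤ L + t := fun x => (ha x).2 _ (Nat.mul_le_mul_right _ (by omega))
  have hbase : ∀ x, _ := fun x => exists_user_group (K₂ := K₂) ((ha x).1 _ hgroup)
    ((ha x).2 _ hcaching) (haq x) (by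
      -- There must be enough cache-less users to fill the group; on average this says `K₂ * (L + t)
      -- ≤ K₂ * D`.
      have : L + t - K₂ ≤ a x := by
        refine (ha x).1 _ ?_
        rcases Nat.eq_zero_or_pos K₂ with h0 | h0
        · subst h0
          rw [hs', hDs]
          simp
        · have h1 := hcacheless h0
          rw [hs']
          rcases le_or_gt (L + t) K₂ with h2 | h2
          · rw [Nat.sub_eq_zero_of_le h2]
            simp
          · obtain ⟨r, hr⟩ := Nat.exists_eq_add_of_le h2.le
            rw [hr, Nat.add_sub_cancel_left]
            rw [hr] at h1
            rw [hDs] at h1 ⊢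
            nlinarith
      omega)
  choose A c hct hcA hck hAcard hAleft using hbase
  have hAright : ∀ x, ((A x).filter fun u => ¬ u.isLeft).card = L + t - a x := by
    intro x
    have := Finset.card_filter_add_card_filter_not (s := A x) (fun u => u.isLeft)
    rw [hAleft, hAcard] at this
    omega
  set Gc := Fintype.card (TypePerm K₁ K₂) with hGc
  have hGc0 : 0 < Gc := Fintype.card_pos
  have hm : 0 < (L + t) * Gc := Nat.mul_pos (by omega) hGc0
  have hTcard : Fintype.card {τ : Finset (Fin K₁) // τ.card = t} = K₁.choose t := by
    rw [Fintype.card_finset_len, Fintype.card_fin]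
  -- Repeating each translate `K₁.choose t` times cancels the number of classes in the orbit count,
  -- so each user meets each class it lacks exactly `(L + t) * Gc` times.
  let ι := (Fin D × Fin (K₁.choose t)) × TypePerm K₁ K₂
  let act : ι → Finset (Fin K₁ ⊕ Fin K₂) := fun i =>
    (A i.1.1).map (userPerm K₁ K₂ i.2).toEmbedding
  let cls : ι → Fin K₁ ⊕ Fin K₂ → {τ : Finset (Fin K₁) // τ.card = t} := fun i u =>
    ⟨cachingSetPerm K₁ K₂ i.2 (c i.1.1 ((userPerm K₁ K₂ i.2).symm u)), by
      rw [cachingSetPerm_apply, Finset.card_map, hct]⟩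
  have hact : ∀ i u, u ∈ act i ↔ (userPerm K₁ K₂ i.2).symm u ∈ A i.1.1 := by
    intro i u
    simp only [act, Finset.mem_map_equiv]
  refine ⟨_, _, ?_, ?_, exists_oneShotScheme_of_schedule (m := (L + t) * Gc) finSumFinEquiv act cls
    (fun θ => θ.1.map Function.Embedding.inl) ?_ hm ?_ (card_users_mem_twoType hγ)⟩
  · rw [hTcard]
    exact Nat.mul_pos hC hm
  · rw [hTcard, Fintype.card_prod, Fintype.card_prod, Fintype.card_fin, Fintype.card_fin, ← hGc]
    have h1 : (0 : ℝ) < K₁.choose t := by exact_mod_cast hC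
    have h2 : (0 : ℝ) < Gc := by exact_mod_cast hGc0
    have h3 : (0 : ℝ) < L + t := by exact_mod_cast (by omega : 0 < L + t)
    push_cast
    field_simp
  · intro i u hu
    set v := (userPerm K₁ K₂ i.2).symm u with hv
    have huv : u = userPerm K₁ K₂ i.2 v := by rw [hv, Equiv.apply_symm_apply]
    have hsub : ((cls i u).1.map Function.Embedding.inl : Finset (Fin K₁ ⊕ Fin K₂)) ⊆
        (act i).erase u := by
      intro w hw
      obtain ⟨k, hk, rfl⟩ := Finset.mem_map.1 hw
      obtain ⟨k', hk', rfl⟩ :=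
        Finset.mem_map.1 (show k ∈ (c i.1.1 v).map i.2.1.toEmbedding from hk)
      refine Finset.mem_erase.2 ⟨fun h => ?_, ?_⟩
      · rw [huv] at h
        have h' := (userPerm K₁ K₂ i.2).injective ((userPerm_inl i.2 k').trans h)
        exact hck i.1.1 k' (h' ▸ hk')
      · refine Finset.mem_map.2 ⟨Sum.inl k', hcA i.1.1 v (Finset.mem_map_of_mem _ hk'), rfl⟩
    rw [Finset.card_sdiff_of_subset hsub, Finset.card_erase_of_mem hu, Finset.card_map,
      Finset.card_map, hAcard, (cls i u).2]
    omega
  · rintro u ⟨τ, hτ⟩ hu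
    have hfilter : (Finset.univ.filter fun i => u ∈ act i ∧ cls i u = ⟨τ, hτ⟩).card =
        K₁.choose t * ∑ x, (Finset.univ.filter fun g => (userPerm K₁ K₂ g).symm u ∈ A x ∧
          cachingSetPerm K₁ K₂ g (c x ((userPerm K₁ K₂ g).symm u)) = τ).card := by
      have h := card_hits_of_product (C := Fin (K₁.choose t))
        fun (x : Fin D) (g : TypePerm K₁ K₂) => (userPerm K₁ K₂ g).symm u ∈ A x ∧
          cachingSetPerm K₁ K₂ g (c x ((userPerm K₁ K₂ g).symm u)) = τ
      rw [Fintype.card_fin] at h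
      rw [← h]
      congr 1
      refine Finset.filter_congr fun i _ => ?_
      rw [hact, Subtype.ext_iff]
    rw [hfilter]
    refine le_of_eq ?_
    rcases u with k | k
    · have hk : k ∉ τ := by simpa using hu
      have h : ∑ x, K₁.choose t * (K₁ - t) *
          (Finset.univ.filter fun g => (userPerm K₁ K₂ g).symm (Sum.inl k) ∈ A x ∧
          cachingSetPerm K₁ K₂ g (c x ((userPerm K₁ K₂ g).symm (Sum.inl k))) = τ).card =
          ∑ x, a x * Gc := Finset.sum_congr rfl fun x _ => by
        rw [card_cachingPairs_mul_card_hits (hct x) (hck x) hτ hk, hAleft]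
      rw [← Finset.mul_sum, ← Finset.sum_mul, hasum] at h
      refine Nat.eq_of_mul_eq_mul_left (by omega : 0 < K₁ - t) ?_
      rw [← mul_assoc, ← mul_assoc, ← h]
      ring
    · have h : ∑ x, K₁.choose t * K₂ *
          (Finset.univ.filter fun g => (userPerm K₁ K₂ g).symm (Sum.inr k) ∈ A x ∧
          cachingSetPerm K₁ K₂ g (c x ((userPerm K₁ K₂ g).symm (Sum.inr k))) = τ).card =
          ∑ x, (L + t - a x) * Gc := Finset.sum_congr rfl fun x _ => by
        rw [card_cachelessPairs_mul_card_hits (hct x) hτ, hAright]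
      have hsum : ∑ x, (L + t - a x) = K₂ * (L + t) := by
        have h1 : ∑ x, (L + t - a x) + ∑ x, a x = D * (L + t) := by
          rw [← Finset.sum_add_distrib,
            Finset.sum_congr rfl (fun x _ => Nat.sub_add_cancel (haq x))]
          simp
        have h2 : D * (L + t) = (s + K₂) * (L + t) := by rw [← hDs]
        rw [hasum, hs'] at h1
        linarith
      rw [← Finset.mul_sum, ← Finset.sum_mul, hsum] at h
      refine Nat.eq_of_mul_eq_mul_left k.pos ?_
      rw [← mul_assoc, ← mul_assoc, ← h]
      ring

/-! ### Converse for linear one-shot schemes -/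

/-- Any `L` of the channels span the whole space, and only zero is orthogonal to it. -/
theorem Channel.Generic.card_lt_of_inner_eq_zero {L K : ℕ} {h : Channel L K} (hh : h.Generic)
    {B : Finset (Fin K)} {v : EuclideanSpace ℂ (Fin L)} (hv : v ≠ 0)
    (hB : ∀ k ∈ B, inner ℂ (h k) v = 0) : B.card < L := by
  by_contra! hLB
  obtain ⟨s, hsB, hs⟩ := Finset.exists_subset_card_eq hLB
  have hspan := (hh s hs.le).span_eq_top_of_card_eq_finrank' (by
    rw [Fintype.card_coe, hs, finrank_euclideanSpace_fin])
  have hmem : v ∈ (⊤ : Submodule ℂ (EuclideanSpace ℂ (Fin L)))ᗮ := by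
    rw [← hspan, Submodule.mem_orthogonal]
    intro u hu
    induction hu using Submodule.span_induction with
    | mem x hx =>
      obtain ⟨k, rfl⟩ := hx
      exact hB _ (hsB k.2)
    | zero => exact inner_zero_left _
    | add x y _ _ hx hy => rw [inner_add_left, hx, hy, add_zero]
    | smul a x _ hx => rw [inner_smul_left, hx, mul_zero]
  rw [Submodule.top_orthogonal_eq_bot, Submodule.mem_bot] at hmem
  exact hv hmem

namespace OneShotScheme

variable {L K N S n : ℕ} {γ : Fin K → ℝ} {h : Channel L K}

/-- The number of users that cache a packet. -/
def copies (σ : OneShotScheme h N γ S n) (p : Fin N × Fin S) : ℕ :=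
  (Finset.univ.filter fun k => p ∈ σ.cached k).card

/-- Besides `j`, the active users either cache its packet or are nulled out by its beam, which can
happen at no more than `L - 1` users. -/
theorem card_active_le (σ : OneShotScheme h N γ S n) (hh : h.Generic) (d : Fin K ↪ Fin N)
    (i : Fin n) {j : Fin K} (hj : j ∈ σ.active d i) :
    (σ.active d i).card ≤ L + σ.copies (d j, σ.packet d i j) := by
  classical
  set B := (σ.active d i).filter fun k => k ≠ j ∧ inner ℂ (h k) (σ.beam d i j) = 0 with hB
  have hBcard : B.card < L := by
    refine hh.card_lt_of_inner_eq_zero (v := σ.beam d i j) ?_ fun k hk =>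
      (Finset.mem_filter.1 hk).2.2
    intro h0
    exact σ.desired d i j hj (by rw [h0, inner_zero_right])
  have hsub : σ.active d i ⊆
      insert j B ∪ Finset.univ.filter fun k => (d j, σ.packet d i j) ∈ σ.cached k := by
    intro k hk
    simp only [Finset.mem_union, Finset.mem_insert, Finset.mem_filter, Finset.mem_univ, true_and,
      hB]
    by_cases hkj : k = j
    · exact Or.inl (Or.inl hkj)
    · rcases σ.interference d i k hk j hj (Ne.symm hkj) with hc | h0
      · exact Or.inr hc
      · exact Or.inl (Or.inr ⟨hk, hkj, h0⟩)
  have h1 := (Finset.card_le_card hsub).trans (Finset.card_union_le _ _)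
  have h2 := Finset.card_insert_le j B
  unfold copies
  omega

/-- Each missing packet is charged to one slot that sends it. A slot with `a` active users is
charged at most `a` packets, each of weight at most `1 / a`. -/
theorem sum_inv_le (σ : OneShotScheme h N γ S n) (hh : h.Generic) (d : Fin K ↪ Fin N) :
    ∑ k, ∑ s, (if (d k, s) ∈ σ.cached k then 0 else ((L : ℝ) + σ.copies (d k, s))⁻¹) ≤ n := by
  classical
  set R : Finset (Fin K × Fin S) := Finset.univ.filter fun x => (d x.1, x.2) ∉ σ.cached x.1 with hR
  rw [← Fintype.sum_prod_type' fun k s => if (d k, s) ∈ σ.cached k then (0 : ℝ) else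
    ((L : ℝ) + σ.copies (d k, s))⁻¹]
  have hsumR : (∑ x : Fin K × Fin S, if (d x.1, x.2) ∈ σ.cached x.1 then (0 : ℝ) else
      ((L : ℝ) + σ.copies (d x.1, x.2))⁻¹) =
      ∑ x ∈ R, ((L : ℝ) + σ.copies (d x.1, x.2))⁻¹ := by
    rw [hR, Finset.sum_filter]
    exact Finset.sum_congr rfl fun x _ => by simp only [ite_not]
  rw [hsumR]
  have hslot : ∀ x : Fin K × Fin S, x ∈ R → ∃ i, x.1 ∈ σ.active d i ∧ σ.packet d i x.1 = x.2 := by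
    intro x hx
    exact σ.complete d x.1 x.2 (Finset.mem_filter.1 hx).2
  rcases Nat.eq_zero_or_pos n with rfl | hn
  · rw [Finset.sum_eq_zero]
    · simp
    · intro x hx
      exact (hslot x hx).choose.elim0
  -- `choose!` needs a default slot, hence the separate case `n = 0`.
  have : Nonempty (Fin n) := ⟨⟨0, hn⟩⟩
  choose! slot hslot_active hslot_packet using hslot
  rw [← Finset.sum_fiberwise R slot]
  calc ∑ i, ∑ x ∈ R with slot x = i, ((L : ℝ) + σ.copies (d x.1, x.2))⁻¹
      ≤ ∑ _i : Fin n, (1 : ℝ) := by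
        refine Finset.sum_le_sum fun i _ => ?_
        have hcard : (R.filter fun x => slot x = i).card ≤ (σ.active d i).card := by
          refine Finset.card_le_card_of_injOn Prod.fst ?_ ?_
          · intro x hx
            obtain ⟨hxR, rfl⟩ := Finset.mem_filter.1 hx
            exact hslot_active x hxR
          · intro x hx y hy hxy
            obtain ⟨hx, hxi⟩ := Finset.mem_filter.1 hx
            obtain ⟨hy, hyi⟩ := Finset.mem_filter.1 hy
            refine Prod.ext hxy ?_
            rw [← hslot_packet x hx, ← hslot_packet y hy, hxi, hyi, hxy]
        rcases (R.filter fun x => slot x = i).eq_empty_or_nonempty with h0 | h0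
        · rw [h0, Finset.sum_empty]
          exact zero_le_one
        have hpos : (0 : ℝ) < (σ.active d i).card := by
          exact_mod_cast h0.card_pos.trans_le hcard
        refine (Finset.sum_le_card_nsmul _ _ ((σ.active d i).card : ℝ)⁻¹ ?_).trans ?_
        · intro x hx
          obtain ⟨hxR, rfl⟩ := Finset.mem_filter.1 hx
          refine inv_anti₀ hpos ?_
          have := σ.card_active_le hh d (slot x) (hslot_active x hxR)
          rw [hslot_packet x hxR] at this
          exact_mod_cast this
        · rw [nsmul_eq_mul, ← div_eq_mul_inv, div_le_one hpos]
          exact_mod_cast hcard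
    _ = n := by simp

/-- Summed over the `N` cyclic shifts of a demand, each user requests each file once, so a packet
`p` is counted for all `K - σ.copies p` users that lack it. -/
theorem sum_div_le (σ : OneShotScheme h N γ S n) (hh : h.Generic) (hN : K ≤ N) (hN0 : 0 < N) :
    ∑ p, ((K : ℝ) - σ.copies p) / (L + σ.copies p) ≤ N * n := by
  classical
  have : NeZero N := ⟨hN0.ne'⟩
  let shift : Fin N → (Fin K ↪ Fin N) := fun x =>
    ⟨fun k => Fin.castLE hN k + x, fun a b hab => Fin.castLE_injective hN (add_right_cancel hab)⟩
  have hsum := Finset.sum_le_sum fun x (_ : x ∈ Finset.univ) => σ.sum_inv_le hh (shift x)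
  rw [Finset.sum_const, Finset.card_univ, Fintype.card_fin, nsmul_eq_mul] at hsum
  refine le_of_eq_of_le ?_ hsum
  rw [Finset.sum_comm]
  have hk : ∀ k, (∑ x, ∑ s, if (shift x k, s) ∈ σ.cached k then (0 : ℝ) else
      ((L : ℝ) + σ.copies (shift x k, s))⁻¹) =
      ∑ p, if p ∈ σ.cached k then (0 : ℝ) else ((L : ℝ) + σ.copies p)⁻¹ := by
    intro k
    rw [Fintype.sum_prod_type]
    exact Fintype.sum_equiv (Equiv.addLeft (Fin.castLE hN k)) _ _ fun x => rfl
  rw [Finset.sum_congr rfl fun k _ => hk k, Finset.sum_comm]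
  refine Finset.sum_congr rfl fun p _ => ?_
  have hcount : (Finset.univ.filter fun k => p ∉ σ.cached k).card = (K : ℝ) - σ.copies p := by
    have h1 := Finset.card_filter_add_card_filter_not (s := Finset.univ)
      (fun k => p ∈ σ.cached k)
    rw [Finset.card_univ, Fintype.card_fin] at h1
    rw [eq_sub_iff_add_eq, add_comm]
    exact_mod_cast h1
  rw [← hcount, div_eq_mul_inv, ← nsmul_eq_mul, ← Finset.sum_const, Finset.sum_filter]
  exact Finset.sum_congr rfl fun k _ => by simp only [ite_not]

/-- No linear one-shot scheme is faster than `(K - τ) / (L + τ)` for users of cumulative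
cache size `τ`. -/
theorem le_delay (σ : OneShotScheme h N γ S n) (hh : h.Generic) (hN : K ≤ N) (hN0 : 0 < N)
    (hS : 0 < S) (hL : 1 ≤ L) {τ : ℝ} (hτ : 0 ≤ τ) (hγ : ∑ k, γ k = τ) :
    ((K : ℝ) - τ) / (L + τ) ≤ n / S := by
  have hL' : (1 : ℝ) ≤ L := by exact_mod_cast hL
  have hS' : (0 : ℝ) < S := by exact_mod_cast hS
  have hN' : (0 : ℝ) < N := by exact_mod_cast hN0
  have hy : (0 : ℝ) < L + τ := by linarith
  have hcopies : ∑ p, (σ.copies p : ℝ) ≤ τ * (N * S) := by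
    have h1 : ∑ p, σ.copies p = ∑ k, (σ.cached k).card := by
      have := Finset.sum_card_bipartiteAbove_eq_sum_card_bipartiteBelow
        (s := Finset.univ) (t := Finset.univ) (fun (p : Fin N × Fin S) k => p ∈ σ.cached k)
      refine this.trans (Finset.sum_congr rfl fun k _ => ?_)
      congr 1
      ext p
      simp [Finset.bipartiteBelow]
    have h2 : ∑ p, (σ.copies p : ℝ) = ∑ k, ((σ.cached k).card : ℝ) := by exact_mod_cast h1
    rw [h2, ← hγ, Finset.sum_mul]
    exact Finset.sum_le_sum fun k _ => σ.cached_le k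
  -- Tangent at `τ` to the convex function `(K - c) / (L + c)`. Its slope is not positive, so an
  -- upper bound on the average number of copies suffices.
  have htangent : ∀ c : ℝ, 0 ≤ c →
      (K - τ) / (L + τ) - (K + L) / (L + τ) ^ 2 * (c - τ) ≤ (K - c) / (L + c) := by
    intro c hc
    have hx : (0 : ℝ) < L + c := by linarith
    rw [← sub_nonneg]
    have : (K - c) / (L + c) - ((K - τ) / (L + τ) - (K + L) / (L + τ) ^ 2 * (c - τ)) =
        (K + L) * (c - τ) ^ 2 / ((L + c) * (L + τ) ^ 2) := by
      field_simp
      ring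
    rw [this]
    positivity
  have hsum : ∑ p : Fin N × Fin S, ((K - τ) / (L + τ) -
      (K + L) / (L + τ) ^ 2 * ((σ.copies p : ℝ) - τ)) ≤ N * n :=
    (Finset.sum_le_sum fun p _ => htangent _ (Nat.cast_nonneg _)).trans (σ.sum_div_le hh hN hN0)
  rw [Finset.sum_sub_distrib, ← Finset.mul_sum, Finset.sum_sub_distrib, Finset.sum_const,
    Finset.sum_const, Finset.card_univ, Fintype.card_prod, Fintype.card_fin, Fintype.card_fin,
    nsmul_eq_mul, nsmul_eq_mul] at hsum
  have hslope : (0 : ℝ) ≤ (K + L) / (L + τ) ^ 2 := by positivity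
  push_cast at hsum
  have h3 : N * ((K - τ) / (L + τ) * S) ≤ N * (n : ℝ) := by nlinarith
  rw [le_div_iff₀ hS']
  exact le_of_mul_le_mul_left h3 hN'

end OneShotScheme

/-! ### The homogeneous system and the conclusion -/

/-- Users with equal caches: `t` of the active users cache the packet of any active user, and it
is nulled out at the `L - 1` others. -/
theorem exists_oneShotScheme_uniform {L K t : ℕ} (N : ℕ) {γ : ℝ} (hL : 1 ≤ L)
    (hγ : (K : ℝ) * γ = t) (ht : t < K) (hLt : L + t ≤ K) :
    ∃ S n : ℕ, 0 < S ∧ (n : ℝ) / S = (K - t) / (L + t) ∧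
      ∃ cached : Fin K → Finset (Fin N × Fin S),
        (∀ k, ((cached k).card : ℝ) ≤ γ * (N * S)) ∧
        ∀ h : Channel L K, h.Generic →
          ∃ σ : OneShotScheme h N (fun _ => γ) S n, σ.cached = cached := by
  -- With `D = K - t` the group conditions reduce to `t + 1 ≤ L + t` and `L + t ≤ K`.
  have h := exists_oneShotScheme_twoType (K₂ := 0) (D := K - t) N hL hγ ht (by omega)
    (Nat.mul_le_mul_left _ (by omega)) (Nat.mul_le_mul_left _ hLt) (by omega)
  have hcaches : twoTypeCaches K 0 γ = fun _ => γ := by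
    funext k
    have hk : (k : ℕ) < K := k.2
    simp [twoTypeCaches, hk]
  rw [hcaches, Nat.cast_sub ht.le] at h
  exact h

theorem corollary4 (L K₁ K₂ N : ℕ) (γ₁ γav : ℝ)
    (hL : 1 ≤ L) (hK₁ : 1 ≤ K₁) (hγ₁ : 0 < γ₁) (hγ₁' : γ₁ < 1)
    (hint : ∃ t : ℕ, (K₁ : ℝ) * γ₁ = t)
    (hN : K₁ + K₂ ≤ N)
    (hγav : γav = K₁ * γ₁ / ((K₁ + K₂ : ℕ) : ℝ))
    (hK₂ : (K₂ : ℝ) ≤ ((L : ℝ) - 1) * singleStreamDelay K₁ γ₁)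
    -- the claimed delay is not below the time that some user would need on its own
    (hT : ∀ k, 1 - twoTypeCaches K₁ K₂ γ₁ k ≤ (K₂ + K₁ * (1 - γ₁)) / (L + K₁ * γ₁)) :
    AchievesDelay L N (twoTypeCaches K₁ K₂ γ₁) ((K₂ + K₁ * (1 - γ₁)) / (L + K₁ * γ₁)) ∧
    (K₂ + K₁ * (1 - γ₁)) / (L + K₁ * γ₁) =
      ((K₁ + K₂ : ℕ) : ℝ) * (1 - γav) / (L + ((K₁ + K₂ : ℕ) : ℝ) * γav) ∧
    ∑ k, twoTypeCaches K₁ K₂ γ₁ k = ∑ _k : Fin (K₁ + K₂), γav ∧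
    AchievesDelay L N (fun _ : Fin (K₁ + K₂) => γav)
      (((K₁ + K₂ : ℕ) : ℝ) * (1 - γav) / (L + ((K₁ + K₂ : ℕ) : ℝ) * γav)) ∧
    OrderOptimalOneShot L N (fun _ : Fin (K₁ + K₂) => γav)
      (((K₁ + K₂ : ℕ) : ℝ) * (1 - γav) / (L + ((K₁ + K₂ : ℕ) : ℝ) * γav)) 2 := by
  obtain ⟨t, hint⟩ := hint
  have hL' : (1 : ℝ) ≤ L := by exact_mod_cast hL
  have hK₁' : (0 : ℝ) < K₁ := by exact_mod_cast hK₁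
  have hK' : (0 : ℝ) < (K₁ + K₂ : ℕ) := by exact_mod_cast (by omega : 0 < K₁ + K₂)
  have ht0 : (0 : ℝ) ≤ t := Nat.cast_nonneg t
  have hLt0 : (0 : ℝ) < L + t := by linarith
  have ht : t < K₁ := by
    have : (t : ℝ) < K₁ := by nlinarith
    exact_mod_cast this
  have hKγ : ((K₁ + K₂ : ℕ) : ℝ) * γav = t := by
    rw [hγav, hint]
    field_simp
  obtain ⟨s, hs⟩ : ∃ s, K₁ = t + s := Nat.exists_eq_add_of_le ht.le
  have hs' : K₁ - t = s := by omega
  have hsr : (K₁ : ℝ) = t + s := by exact_mod_cast hs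
  have hs0 : 0 < s := by omega
  have htwo : ((K₂ : ℝ) + K₁ * (1 - γ₁)) / (L + K₁ * γ₁) = (s + K₂ : ℕ) / (L + t) := by
    rw [mul_sub, hint, hsr]
    push_cast
    ring
  have huni : ((K₁ + K₂ : ℕ) : ℝ) * (1 - γav) / (L + ((K₁ + K₂ : ℕ) : ℝ) * γav) =
      ((K₁ + K₂ : ℕ) - t) / (L + t) := by
    rw [mul_sub, hKγ, mul_one]
  have htwo_uni : (((s + K₂ : ℕ) : ℝ)) / (L + t) = ((K₁ + K₂ : ℕ) - t) / (L + t) := by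
    push_cast
    rw [hsr]
    ring
  -- This is `K₂ * (t + 1) ≤ s * (L - 1)`, the bound `hK₂` cleared of denominators.
  have hgroup : (s + K₂) * (t + 1) ≤ (K₁ - t) * (L + t) := by
    rw [singleStreamDelay, mul_sub, hint, hsr, ← mul_div_assoc, le_div_iff₀ (by linarith)] at hK₂
    have : ((s : ℝ) + K₂) * (t + 1) ≤ s * (L + t) := by nlinarith
    rw [hs']
    exact_mod_cast this
  have hcaching : (K₁ - t) * (L + t) ≤ (s + K₂) * K₁ := by
    -- User `0` caches; user `K₁`, used for `hcacheless`, is the first without a cache.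
    have h := hT ⟨0, by omega⟩
    have h0 : 0 < K₁ := hK₁
    rw [htwo, le_div_iff₀ hLt0] at h
    simp only [twoTypeCaches, h0, if_true] at h
    have : (s : ℝ) * (L + t) ≤ (s + K₂ : ℕ) * K₁ := by
      have hs2 : (s : ℝ) = K₁ * (1 - γ₁) := by linarith
      calc (s : ℝ) * (L + t) = K₁ * ((1 - γ₁) * (L + t)) := by rw [hs2]; ring
        _ ≤ K₁ * (s + K₂ : ℕ) := by gcongr
        _ = _ := mul_comm _ _
    rw [hs']
    exact_mod_cast this
  have hcacheless : 0 < K₂ → L + t ≤ s + K₂ := by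
    intro h0
    have h := hT ⟨K₁, by omega⟩
    rw [htwo, le_div_iff₀ hLt0] at h
    simp only [twoTypeCaches, lt_irrefl, if_false, sub_zero, one_mul] at h
    exact_mod_cast h
  have hLt : L + t ≤ K₁ + K₂ := by
    rcases Nat.eq_zero_or_pos K₂ with rfl | h0
    · rw [hs', add_zero] at hcaching
      exact Nat.le_of_mul_le_mul_left hcaching hs0
    · have := hcacheless h0
      omega
  obtain ⟨S, n, hS, hSn, cached, hcached, hscheme⟩ := exists_oneShotScheme_twoType (K₂ := K₂) N hL
    hint ht (by omega) hgroup hcaching hcacheless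
  obtain ⟨S', n', hS', hSn', cached', hcached', hscheme'⟩ :=
    exists_oneShotScheme_uniform N hL hKγ (by omega) hLt
  refine ⟨?_, ?_, ?_, ?_, fun h hh => ⟨⟨S', n', hS', ?_, ?_⟩, fun S'' n'' hS'' ⟨σ⟩ => ?_⟩⟩
  · rw [htwo, ← hSn]
    exact achievesDelay_of_oneShotScheme hS cached hcached hscheme
  · rw [htwo, huni, htwo_uni]
  · rw [Fin.sum_univ_add, Finset.sum_const, Finset.card_univ, Fintype.card_fin, nsmul_eq_mul, hKγ]
    simp [twoTypeCaches, hint]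
  · rw [huni, ← hSn']
    exact achievesDelay_of_oneShotScheme hS' cached' hcached' hscheme'
  · rw [huni, hSn']
  · exact (hscheme' h hh).nonempty
  · rw [huni]
    -- This already gives the bound with factor `1`.
    have h1 := σ.le_delay hh hN (by omega) hS'' hL ht0 (by
      rw [Finset.sum_const, Finset.card_univ, Fintype.card_fin, nsmul_eq_mul, hKγ])
    have h2 : (0 : ℝ) ≤ (n'' : ℝ) / S'' := by positivity
    linarith
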